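/- \textbf{Setting.} Let $\tau>0$ and let $B\colon[0,\tau]\to\mathbf R$ be continuous with $B(0)=0$, $B(\tau)=1$ and $|B(t)|<1$ for $0\le t<\tau$ (for example a path of a Brownian motion started from $0$, conditioned to hit $1$ before $-1$, and stopped upon hitting $1$). Let $\Gamma=\{(t,B(t)):t\in[0,\tau]\}\subseteq\mathbf R^2$ be its graph. Let $K\in\mathbf N$ and $r,c>0$ with $rK\in\mathbf N$, and put $s=c/2$ and $\mathcal M=\{-3rK,-3rK+1,\dots,K-rK-1\}$. For $n\ge0$ let $T^n_0=0$ and $T^n_{j+1}=\inf\{t>T^n_j:|B(t)-B(T^n_j)|=K^{-n}\}$. A \emph{box at scale $n$} is a rectangle $R=[T^n_j,T^n_{j+1}]\times[\ell K^{-n},(\ell+1)K^{-n}]$ with $T^n_{j+1}\le\tau$, $\ell\in\mathbf Z$, $B(T^n_j)=\ell K^{-n}$ and $B(T^n_{j+1})=(\ell+1)K^{-n}$. Its \emph{children} at height $m\in\mathcal M$ are the boxes at scale $n+1$ with lower boundary at height $\ell K^{-n}+mK^{-(n+1)}$ whose projection to the time axis is contained in $[T^n_j,T^n_{j+1}]$.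 The box $R$ is in $\mathcal G_1$ if for each $m\in\mathcal M$ the restriction of $B$ to $[T^n_j,T^n_{j+1}]$ makes at least $sK$ upcrossings of $[\ell K^{-n}+mK^{-(n+1)},\ell K^{-n}+(m+1)K^{-(n+1)}]$; for $k\ge1$ it is in $\mathcal G_{k+1}$ if for each $m\in\mathcal M$ it has at least $sK$ children at height $m$ that are in $\mathcal G_k$; and $\mathcal G_\infty=\bigcap_{k\ge1}\mathcal G_k$. Let $R_0=[0,\tau]\times[0,1]$ be the box at scale $0$. A \emph{nested family} consists of sets $\mathcal F_n$ of boxes at scale $n$ in $\mathcal G_\infty$, $n\ge0$, with $\mathcal F_0=\{R_0\}$, such that every box in $\mathcal F_{n+1}$ is a child of a box in $\mathcal F_n$, and every box in $\mathcal F_n$ has, at each height $m\in\mathcal M$, at least $sK$ children in $\mathcal F_{n+1}$. Let $\Gamma_n$ be the union, over the boxes in $\mathcal F_n$, of the box together with the rectangle of the same width and of height $3rK^{-n}$ directly below it. For $p\in[1,\infty]$, a compact set $E\subseteq\mathbf R^2$ is \emph{$W^{1,p}$-removable} if every continuous $f\colon\mathbf R^2\to\mathbf R$ with $f\in W^{1,p}(\mathbf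 R^2\setminus E)$ is in $W^{1,p}(\mathbf R^2)$. \textbf{Proposition.} Fix $p\in[1,\infty)$ and suppose that $K>s^{-p}$ and $R_0\in\mathcal G_\infty$. Then the compact set $\Gamma$ is not $W^{1,p}$-removable. Moreover, nested families exist, and for every nested family the set $\bigcap_n\Gamma_n$ is a compact subset of $\Gamma$ that is not $W^{1,p}$-removable. -/

import Mathlib

open MeasureTheory Set
open scoped ContDiff ENNReal

/-! ### Sobolev spaces and removability in the plane -/

/-- `g` is the weak derivative of `f` in the direction `v` on the open set `Ω ⊆ ℝ²`. -/
def HasWeakDerivOn (Ω : Set (ℝ × ℝ)) (v : ℝ × ℝ) (f g : ℝ × ℝ → ℝ) : Prop :=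
  ∀ ψ : ℝ × ℝ → ℝ, ContDiff ℝ ∞ ψ → HasCompactSupport ψ → tsupport ψ ⊆ Ω →
    ∫ z in Ω, f z * fderiv ℝ ψ z v = - ∫ z in Ω, g z * ψ z

/-- `f ∈ W^{1,p}(Ω)`: `f` and its two weak partial derivatives lie in `L^p(Ω)`. -/
def MemW1p (Ω : Set (ℝ × ℝ)) (p : ℝ≥0∞) (f : ℝ × ℝ → ℝ) : Prop :=
  MemLp f p (volume.restrict Ω) ∧
    ∃ gx gy : ℝ × ℝ → ℝ,
      MemLp gx p (volume.restrict Ω) ∧ MemLp gy p (volume.restrict Ω) ∧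
      HasWeakDerivOn Ω (1, 0) f gx ∧ HasWeakDerivOn Ω (0, 1) f gy

/-- The (compact) set `E ⊆ D` is `W^{1,p}`-removable inside the domain `D`. -/
def IsW1pRemovableIn (D : Set (ℝ × ℝ)) (p : ℝ≥0∞) (E : Set (ℝ × ℝ)) : Prop :=
  ∀ f : ℝ × ℝ → ℝ, ContinuousOn f D → MemW1p (D \ E) p f → MemW1p D p f

/-- The (compact) set `E` is `W^{1,p}`-removable, i.e. removable inside the whole plane. -/
def IsW1pRemovable (p : ℝ≥0∞) (E : Set (ℝ × ℝ)) : Prop :=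
  IsW1pRemovableIn univ p E

/-! ### Boxes of a path -/

/-- The graph of `B` over `[0, τ]`. -/
def pathGraph (B : ℝ → ℝ) (τ : ℝ) : Set (ℝ × ℝ) :=
  (fun t => (t, B t)) '' Icc 0 τ

/-- `IsCrossingTime B δ j t` says that `T_j` exists and equals `t`, where `T_0 = 0` and
`T_{j+1}` is the first time after `T_j` at which `|B - B(T_j)| = δ`. -/
inductive IsCrossingTime (B : ℝ → ℝ) (δ : ℝ) : ℕ → ℝ → Prop
  | zero : IsCrossingTime B δ 0 0
  | succ {j : ℕ} {t t' : ℝ} : IsCrossingTime B δ j t →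
      IsLeast {u | t < u ∧ |B u - B t| = δ} t' → IsCrossingTime B δ (j + 1) t'

/-- The data of a box: its left and right boundary, and the integer `ℓ` for which (at scale `n`)
its lower and upper boundary are at heights `ℓ K^{-n}` and `(ℓ + 1) K^{-n}`. -/
@[ext]
structure PathBox where
  left : ℝ
  right : ℝ
  level : ℤ

/-- The height `K^{-n}` of the boxes at scale `n`. -/
noncomputable def mesh (K n : ℕ) : ℝ := ((K : ℝ) ^ n)⁻¹

/-- `R` is a box at scale `n` of the path `B` stopped at `τ`: its sides are two consecutive
crossing times, at most `τ`, between which the path goes from `ℓ K^{-n}` up to `(ℓ+1) K^{-n}`. -/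
def IsBox (B : ℝ → ℝ) (τ : ℝ) (K n : ℕ) (R : PathBox) : Prop :=
  (∃ j : ℕ, IsCrossingTime B (mesh K n) j R.left ∧ IsCrossingTime B (mesh K n) (j + 1) R.right) ∧
    R.right ≤ τ ∧
    B R.left = R.level * mesh K n ∧ B R.right = (R.level + 1) * mesh K n

/-- The set `{-3rK, -3rK + 1, …, K - rK - 1}` of relative heights of children. -/
def childHeights (r : ℝ) (K : ℕ) : Set ℤ :=
  {m | -(3 * r * K) ≤ (m : ℝ) ∧ (m : ℝ) ≤ K - r * K - 1}

/-- `R'` (at scale `n + 1`) is a child of `R` (at scale `n`) at relative height `m`. -/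
def IsChildAt (B : ℝ → ℝ) (τ : ℝ) (K n : ℕ) (R R' : PathBox) (m : ℤ) : Prop :=
  IsBox B τ K (n + 1) R' ∧ R.left ≤ R'.left ∧ R'.right ≤ R.right ∧
    R'.level = R.level * K + m

/-- On the time interval `[t₀, t₁]` the path makes at least `N` upcrossings of `[a, b]`. -/
def HasUpcrossings (B : ℝ → ℝ) (t₀ t₁ a b : ℝ) (N : ℕ) : Prop :=
  ∃ σ ρ : Fin N → ℝ,
    (∀ i, t₀ ≤ σ i ∧ σ i < ρ i ∧ ρ i ≤ t₁ ∧ B (σ i) ≤ a ∧ b ≤ B (ρ i)) ∧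
    ∀ i j, i < j → ρ i ≤ σ j

/-- The box `R` at scale `n` is `(r, c)`-good: there are at least `c K` upcrossings inside `R` of
each interval `[ℓ K^{-n} + m K^{-(n+1)}, ℓ K^{-n} + (m+1) K^{-(n+1)}]`. -/
def IsGoodBox (B : ℝ → ℝ) (τ : ℝ) (K : ℕ) (r c : ℝ) (n : ℕ) (R : PathBox) : Prop :=
  IsBox B τ K n R ∧ ∀ m ∈ childHeights r K, ∃ N : ℕ, c * K ≤ N ∧
    HasUpcrossings B R.left R.right
      (R.level * mesh K n + m * mesh K (n + 1))
      (R.level * mesh K n + (m + 1) * mesh K (n + 1)) N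

/-- `IsNGood B τ K r s k n R`: the box `R` at scale `n` is `k`-good with parameter `s`.
It is meaningful for `k ≥ 1`; the value at `k = 0` is a placeholder that nothing refers to. -/
def IsNGood (B : ℝ → ℝ) (τ : ℝ) (K : ℕ) (r s : ℝ) : ℕ → ℕ → PathBox → Prop
  | 0, n, R => IsBox B τ K n R
  | 1, n, R => IsGoodBox B τ K r s n R
  | k + 2, n, R => IsBox B τ K n R ∧ ∀ m ∈ childHeights r K,
      ∃ S : Finset PathBox, s * K ≤ (S.card : ℝ) ∧
        ∀ R' ∈ S, IsChildAt B τ K n R R' m ∧ IsNGood B τ K r s (k + 1) (n + 1) R'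

/-- The box `R` at scale `n` is `k`-good for every `k ≥ 1`. -/
def IsInftyGood (B : ℝ → ℝ) (τ : ℝ) (K : ℕ) (r s : ℝ) (n : ℕ) (R : PathBox) : Prop :=
  ∀ k : ℕ, 1 ≤ k → IsNGood B τ K r s k n R

/-- The box `[0, τ] × [0, 1]` at scale `0`. -/
def rootBox (τ : ℝ) : PathBox := ⟨0, τ, 0⟩

/-- `F n` is the set of members at scale `n` of an infinite nested family of infinitely good boxes
that starts from the box at scale `0` and in which every member has at least `s K` children
at each of the possible heights. -/
structure IsNestedFamily (B : ℝ → ℝ) (τ : ℝ) (K : ℕ) (r s : ℝ)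
    (F : ℕ → Set PathBox) : Prop where
  root : F 0 = {rootBox τ}
  good : ∀ n, ∀ R ∈ F n, IsInftyGood B τ K r s n R
  nested : ∀ n, ∀ R' ∈ F (n + 1), ∃ R ∈ F n, ∃ m ∈ childHeights r K, IsChildAt B τ K n R R' m
  children : ∀ n, ∀ R ∈ F n, ∀ m ∈ childHeights r K,
    ∃ S : Finset PathBox, s * K ≤ (S.card : ℝ) ∧
      ∀ R' ∈ S, R' ∈ F (n + 1) ∧ IsChildAt B τ K n R R' m

/-- The rectangle of a box at scale `n`, together with the rectangle of the same width and of
height `3 r K^{-n}` directly below it. -/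
def PathBox.extended (r : ℝ) (K n : ℕ) (R : PathBox) : Set (ℝ × ℝ) :=
  Icc R.left R.right ×ˢ Icc ((R.level - 3 * r) * mesh K n) ((R.level + 1) * mesh K n)

/-- The intersection over all scales `n` of the union of the (extended) boxes at scale `n`. -/
def familyLimitSet (r : ℝ) (K : ℕ) (F : ℕ → Set PathBox) : Set (ℝ × ℝ) :=
  ⋂ n : ℕ, ⋃ R ∈ F n, R.extended r K n

/-
At each height `y` a nested family determines a random nested sequence of boxes: start with the
root and choose uniformly among the children whose row contains `y`. The distribution function in
`x` of the point on which these boxes shrink is a devil's staircase. As it climbs inside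
`⋂ n, Γ_n` only, the witness of non-removability is a function that is locally constant in `x` off
this null set, so that its horizontal derivative there vanishes, but whose total climb does not.
To make the dependence on `y` smooth, the indicators of the rows are replaced by a partition of
unity into trapezoids; their slopes need the overlap that the rectangles below the boxes provide.
Every box has at least `q = s K` children in each row, so a box at scale `n` carries a share at
most `q⁻ⁿ` of the climb, and the change of the rows at this scale contributes at most a multiple of
`Kⁿ q⁻ⁿ = s⁻ⁿ` to the vertical derivative, on a set of area at most a multiple of `K⁻ⁿ`. The
`L^p` norms of these contributions are summable because `s⁻ᵖ < K`.
-/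

open Filter
open scoped BigOperators Topology

/-! ### Weak derivatives -/

theorem hasWeakDerivOn_iff_integral {Ω : Set (ℝ × ℝ)} {v : ℝ × ℝ} {f g : ℝ × ℝ → ℝ} :
    HasWeakDerivOn Ω v f g ↔ ∀ ψ : ℝ × ℝ → ℝ, ContDiff ℝ ∞ ψ → HasCompactSupport ψ →
      tsupport ψ ⊆ Ω → ∫ z, f z * fderiv ℝ ψ z v = - ∫ z, g z * ψ z := by
  refine forall₄_congr fun ψ _ _ hψΩ => ?_
  rw [setIntegral_eq_integral_of_forall_compl_eq_zero fun z hz => ?_,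
    setIntegral_eq_integral_of_forall_compl_eq_zero fun z hz => ?_]
  · rw [image_eq_zero_of_notMem_tsupport (notMem_subset hψΩ hz), mul_zero]
  · rw [fderiv_of_notMem_tsupport ℝ (notMem_subset hψΩ hz), zero_apply, mul_zero]

theorem hasWeakDerivOn_fderiv {Ω : Set (ℝ × ℝ)} {v : ℝ × ℝ} {f : ℝ × ℝ → ℝ} (hf : Continuous f)
    (hdiff : ∀ z ∈ Ω, DifferentiableAt ℝ f z)
    (hloc : LocallyIntegrable fun z => fderiv ℝ f z v) :
    HasWeakDerivOn Ω v f fun z => fderiv ℝ f z v := by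
  refine hasWeakDerivOn_iff_integral.2 fun ψ hψ hψc hψΩ => ?_
  have hψ' : Continuous fun z => fderiv ℝ ψ z v :=
    (hψ.continuous_fderiv (by simp)).clm_apply continuous_const
  refine integral_mul_fderiv_eq_neg_fderiv_mul_of_integrable ?_ ?_ ?_
    (fun z hz => hdiff z (hψΩ hz)) (fun z _ => hψ.differentiable (by simp) z)
  · exact hloc.integrable_smul_right_of_hasCompactSupport hψ.continuous hψc
  · exact (hf.mul hψ').integrable_of_hasCompactSupport (hψc.fderiv_apply (𝕜 := ℝ) v).mul_left
  · exact (hf.mul hψ.continuous).integrable_of_hasCompactSupport hψc.mul_left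

namespace HasWeakDerivOn

variable {Ω Ω' : Set (ℝ × ℝ)} {v : ℝ × ℝ} {f g g' : ℝ × ℝ → ℝ}

theorem mono (h : HasWeakDerivOn Ω' v f g) (hΩ : Ω ⊆ Ω') : HasWeakDerivOn Ω v f g :=
  hasWeakDerivOn_iff_integral.2 fun ψ hψ hψc hψΩ =>
    hasWeakDerivOn_iff_integral.1 h ψ hψ hψc (hψΩ.trans hΩ)

theorem ae_eq (hΩ : IsOpen Ω) (h : HasWeakDerivOn Ω v f g) (h' : HasWeakDerivOn Ω v f g')
    (hg : LocallyIntegrable g) (hg' : LocallyIntegrable g') : ∀ᵐ z, z ∈ Ω → g z = g' z := by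
  have hzero : ∀ᵐ z, z ∈ Ω → (g - g') z = 0 := by
    refine hΩ.ae_eq_zero_of_integral_contDiff_smul_eq_zero
      ((hg.sub hg').locallyIntegrableOn _) fun ψ hψ hψc hψΩ => ?_
    have heq := (hasWeakDerivOn_iff_integral.1 h ψ hψ hψc hψΩ).symm.trans
      (hasWeakDerivOn_iff_integral.1 h' ψ hψ hψc hψΩ)
    simp only [Pi.sub_apply, smul_eq_mul, mul_comm (ψ _), sub_mul]
    rw [integral_sub, neg_injective heq, sub_self]
    · exact hg.integrable_smul_right_of_hasCompactSupport hψ.continuous hψc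
    · exact hg'.integrable_smul_right_of_hasCompactSupport hψ.continuous hψc
  filter_upwards [hzero] with z hz hzΩ using sub_eq_zero.1 (hz hzΩ)

theorem integral_eq_zero (h : HasWeakDerivOn univ v f g) (hf : HasCompactSupport f)
    (hg : HasCompactSupport g) : ∫ z, g z = 0 := by
  obtain ⟨ρ, hρ0, hρ⟩ := (hf.isCompact.union hg.isCompact).isBounded.subset_ball_lt 0 (0 : ℝ × ℝ)
  let ψ : ContDiffBump (0 : ℝ × ℝ) := ⟨ρ, ρ + 1, hρ0, lt_add_one ρ⟩
  have hψ : ∀ z ∈ Metric.ball (0 : ℝ × ℝ) ρ, ψ z = 1 := fun z hz =>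
    ψ.one_of_mem_closedBall (Metric.ball_subset_closedBall hz)
  have hfψ : ∀ z, f z * fderiv ℝ ψ z v = 0 := fun z => by
    by_cases hz : z ∈ Metric.ball (0 : ℝ × ℝ) ρ
    · have hev : (ψ : ℝ × ℝ → ℝ) =ᶠ[nhds z] fun _ => 1 := by
        filter_upwards [Metric.isOpen_ball.mem_nhds hz] using hψ
      simp [hev.fderiv_eq]
    · rw [image_eq_zero_of_notMem_tsupport fun hzf => hz (hρ (Or.inl hzf)), zero_mul]
  have hgψ : ∀ z, g z * ψ z = g z := fun z => by
    by_cases hz : z ∈ Metric.ball (0 : ℝ × ℝ) ρ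
    · rw [hψ z hz, mul_one]
    · rw [image_eq_zero_of_notMem_tsupport fun hzg => hz (hρ (Or.inr hzg)), zero_mul]
  simpa [hfψ, hgψ] using
    hasWeakDerivOn_iff_integral.1 h ψ ψ.contDiff ψ.hasCompactSupport (subset_univ _)

end HasWeakDerivOn

theorem not_isW1pRemovable_of_integral_fderiv_ne_zero {p : ℝ≥0∞} (hp : 1 ≤ p)
    {E : Set (ℝ × ℝ)} (hE : IsClosed E) (hE0 : volume E = 0) {f : ℝ × ℝ → ℝ}
    (hf : Continuous f) (hfc : HasCompactSupport f) (hdiff : ∀ z ∉ E, DifferentiableAt ℝ f z)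
    (hx : MemLp (fun z => fderiv ℝ f z (1, 0)) p) (hy : MemLp (fun z => fderiv ℝ f z (0, 1)) p)
    (hne : ∫ z, fderiv ℝ f z (1, 0) ≠ 0) : ¬ IsW1pRemovable p E := by
  intro hrem
  have hEc : ∀ᵐ z, z ∈ Eᶜ := compl_mem_ae_iff.2 hE0
  have hrestrict : (volume : Measure (ℝ × ℝ)).restrict Eᶜ = volume :=
    Measure.restrict_eq_self_of_ae_mem hEc
  have hweak := fun v hv => hasWeakDerivOn_fderiv (Ω := Eᶜ) (v := v) hf hdiff hv
  have hW : MemW1p Eᶜ p f := by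
    refine ⟨?_, _, _, ?_, ?_, hweak _ (hx.locallyIntegrable hp), hweak _ (hy.locallyIntegrable hp)⟩
      <;> rw [hrestrict]
    exacts [hf.memLp_of_hasCompactSupport hfc, hx, hy]
  obtain ⟨-, g, -, hg, -, hfg, -⟩ := hrem f hf.continuousOn (compl_eq_univ_sdiff E ▸ hW)
  rw [Measure.restrict_univ] at hg
  have hae : ∀ᵐ z, z ∈ Eᶜ → fderiv ℝ f z (1, 0) = g z :=
    (hweak _ (hx.locallyIntegrable hp)).ae_eq hE.isOpen_compl (hfg.mono (subset_univ _))
      (hx.locallyIntegrable hp) (hg.locallyIntegrable hp)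
  have hfderiv : HasWeakDerivOn univ (1, 0) f fun z => fderiv ℝ f z (1, 0) := by
    refine hasWeakDerivOn_iff_integral.2 fun ψ hψ hψc hψΩ => ?_
    rw [hasWeakDerivOn_iff_integral.1 hfg ψ hψ hψc hψΩ, neg_inj]
    refine integral_congr_ae ?_
    filter_upwards [hae, hEc] with z hz hzE
    rw [hz hzE]
  exact hne (hfderiv.integral_eq_zero hfc (hfc.fderiv_apply (𝕜 := ℝ) _))

/-! ### Trapezoids and weighted sums -/

/-- A smooth bump function supported in `[-3r, 1 - 2r]`, the vertical extent of an extended box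
at scale `0` and level `0` with the top `2r` removed; its integer translates sum to `1`. -/
noncomputable def trapezoid (r t : ℝ) : ℝ :=
  Real.smoothTransition ((t + 3 * r) / r) - Real.smoothTransition ((t + 3 * r - 1) / r)

theorem contDiff_trapezoid (r : ℝ) : ContDiff ℝ ∞ (trapezoid r) :=
  (Real.smoothTransition.contDiff.comp (by fun_prop)).sub
    (Real.smoothTransition.contDiff.comp (by fun_prop))

theorem trapezoid_le_one (r t : ℝ) : trapezoid r t ≤ 1 :=
  (sub_le_self _ (Real.smoothTransition.nonneg _)).trans (Real.smoothTransition.le_one _)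

theorem sum_trapezoid_eq_sub (r t : ℝ) (N : ℕ) :
    ∑ i : Fin N, trapezoid r (t - (i : ℕ)) =
      Real.smoothTransition ((t + 3 * r) / r) - Real.smoothTransition ((t + 3 * r - N) / r) := by
  rw [Fin.sum_univ_eq_sum_range fun i => trapezoid r (t - i)]
  have hstep : ∀ i : ℕ, trapezoid r (t - i) = Real.smoothTransition ((t + 3 * r - i) / r) -
      Real.smoothTransition ((t + 3 * r - (i + 1 : ℕ)) / r) := fun i => by
    rw [trapezoid]; push_cast; ring_nf
  simp only [hstep, Finset.sum_range_sub', Nat.cast_zero, sub_zero]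

theorem sum_trapezoid_le_one (r t : ℝ) (N : ℕ) : ∑ i : Fin N, trapezoid r (t - (i : ℕ)) ≤ 1 := by
  rw [sum_trapezoid_eq_sub]
  exact (sub_le_self _ (Real.smoothTransition.nonneg _)).trans (Real.smoothTransition.le_one _)

theorem trapezoid_nonneg {r : ℝ} (hr : 0 < r) (t : ℝ) : 0 ≤ trapezoid r t :=
  sub_nonneg.2 (Real.smoothTransition.monotone (by gcongr; linarith))

theorem mem_Ioo_of_trapezoid_ne_zero {r t : ℝ} (hr : 0 < r) (ht : trapezoid r t ≠ 0) :
    t ∈ Ioo (-(3 * r)) (1 - 2 * r) := by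
  contrapose! ht
  rw [mem_Ioo, not_and_or, not_lt, not_lt] at ht
  rcases ht with h | h
  · rw [trapezoid, Real.smoothTransition.zero_of_nonpos, Real.smoothTransition.zero_of_nonpos,
      sub_zero]
    all_goals exact div_nonpos_of_nonpos_of_nonneg (by linarith) hr.le
  · rw [trapezoid, Real.smoothTransition.one_of_one_le, Real.smoothTransition.one_of_one_le,
      sub_self]
    all_goals rw [le_div_iff₀ hr]; linarith

theorem hasCompactSupport_trapezoid {r : ℝ} (hr : 0 < r) : HasCompactSupport (trapezoid r) :=
  HasCompactSupport.intro isCompact_Icc fun _ ht =>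
    of_not_not fun h => ht (Ioo_subset_Icc_self (mem_Ioo_of_trapezoid_ne_zero hr h))

theorem exists_abs_deriv_trapezoid_le {r : ℝ} (hr : 0 < r) :
    ∃ D, ∀ t, |deriv (trapezoid r) t| ≤ D :=
  (hasCompactSupport_trapezoid hr).deriv.exists_bound_of_continuous
    ((contDiff_trapezoid r).continuous_deriv (by simp))

theorem sum_trapezoid_eq_one {r t : ℝ} (hr : 0 < r) {N : ℕ}
    (ht : t ∈ Icc (-(2 * r)) (N - 3 * r)) : ∑ i : Fin N, trapezoid r (t - (i : ℕ)) = 1 := by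
  rw [sum_trapezoid_eq_sub, Real.smoothTransition.one_of_one_le,
    Real.smoothTransition.zero_of_nonpos, sub_zero]
  · exact div_nonpos_of_nonpos_of_nonneg (by linarith [ht.2]) hr.le
  · rw [le_div_iff₀ hr]; linarith [ht.1]

theorem integral_trapezoid_pos {r : ℝ} (hr : 0 < r) : 0 < ∫ t, trapezoid r t := by
  refine (contDiff_trapezoid r).continuous.integral_pos_of_hasCompactSupport_nonneg_nonzero
    (x := -(2 * r)) (hasCompactSupport_trapezoid hr) (trapezoid_nonneg hr) (ne_of_gt ?_)
  rw [trapezoid, Real.smoothTransition.one_of_one_le, sub_pos]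
  · exact Real.smoothTransition.lt_one_of_lt_one ((div_lt_one hr).2 (by linarith))
  · exact (one_le_div hr).2 (by linarith)

section WeightedSums

variable {ι : Type*} {s : Finset ι} {w a : ι → ℝ}

theorem abs_sum_mul_le_of_sum_le_one {D : ℝ} (hw : ∀ i ∈ s, 0 ≤ w i) (hsum : ∑ i ∈ s, w i ≤ 1)
    (hD : 0 ≤ D) (ha : ∀ i ∈ s, w i ≠ 0 → |a i| ≤ D) : |∑ i ∈ s, w i * a i| ≤ D :=
  calc |∑ i ∈ s, w i * a i|
      ≤ ∑ i ∈ s, |w i * a i| := Finset.abs_sum_le_sum_abs _ _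
    _ ≤ ∑ i ∈ s, w i * D := by
        refine Finset.sum_le_sum fun i hi => ?_
        rw [abs_mul, abs_of_nonneg (hw i hi)]
        rcases eq_or_ne (w i) 0 with h | h
        · simp [h]
        · exact mul_le_mul_of_nonneg_left (ha i hi h) (hw i hi)
    _ ≤ D := by
        rw [← Finset.sum_mul]
        exact mul_le_of_le_one_left hD hsum

theorem sum_mul_eq_of_sum_eq_one {c : ℝ} (hsum : ∑ i ∈ s, w i = 1)
    (ha : ∀ i ∈ s, w i ≠ 0 → a i = c) : ∑ i ∈ s, w i * a i = c := by
  rw [← one_mul c, ← hsum, Finset.sum_mul]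
  refine Finset.sum_congr rfl fun i hi => ?_
  rcases eq_or_ne (w i) 0 with h | h
  · simp [h]
  · rw [ha i hi h]

theorem abs_expect_le_of_pairwiseDisjoint {α : Type*} {I : ι → Set α} {x : α} {q D : ℝ}
    (hq : 0 < q) (hqs : q ≤ s.card) (hI : (s : Set ι).PairwiseDisjoint I) (hD : 0 ≤ D)
    (ha0 : ∀ i ∈ s, x ∉ I i → a i = 0) (ha : ∀ i ∈ s, x ∈ I i → |a i| ≤ D) :
    |𝔼 i ∈ s, a i| ≤ q⁻¹ * D := by
  have hsum : |∑ i ∈ s, a i| ≤ D := by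
    by_cases h : ∃ i ∈ s, x ∈ I i
    · obtain ⟨i, hi, hxi⟩ := h
      rw [Finset.sum_eq_single_of_mem i hi fun j hj hji => ha0 j hj fun hxj =>
        disjoint_left.1 (hI hj hi hji) hxj hxi]
      exact ha i hi hxi
    · push Not at h
      rwa [Finset.sum_eq_zero fun i hi => ha0 i hi (h i hi), abs_zero]
  rw [Finset.expect_eq_sum_div_card, abs_div, Nat.abs_cast, div_eq_inv_mul]
  exact mul_le_mul (inv_anti₀ hq hqs) hsum (abs_nonneg _) (inv_nonneg.2 hq.le)

end WeightedSums

/-! ### Staircases over a tree of boxes -/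

/-- The combinatorial skeleton of a nested family: a tree of boxes in which every box at scale `n`
has, in each of the `K + 2k` rows at relative heights `-3k, …, K - k - 1` with `k = r K`, at
least `q > 1` children, whose time intervals lie in that of the parent and do not overlap. The
row at relative height `i - 3k` has the index `i : Fin (K + 2k)`. -/
structure BoxTree (r q : ℝ) (K : ℕ) where
  k : ℕ
  mul_eq : r * K = k
  r_pos : 0 < r
  three_le : 3 ≤ K
  one_lt : 1 < q
  Node : ℕ → Type
  root : Node 0
  box {n : ℕ} : Node n → PathBox
  children {n : ℕ} : Node n → Fin (K + 2 * k) → Finset (Node (n + 1))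
  left_lt_right {n : ℕ} (R : Node n) : (box R).left < (box R).right
  left_le {n : ℕ} {R : Node n} {i} {R' : Node (n + 1)} :
    R' ∈ children R i → (box R).left ≤ (box R').left
  right_le {n : ℕ} {R : Node n} {i} {R' : Node (n + 1)} :
    R' ∈ children R i → (box R').right ≤ (box R).right
  level_eq {n : ℕ} {R : Node n} {i} {R' : Node (n + 1)} :
    R' ∈ children R i → (box R').level = (box R).level * K + ((i : ℕ) - 3 * k)
  le_card {n : ℕ} (R : Node n) (i) : q ≤ (children R i).card
  pairwiseDisjoint {n : ℕ} (R : Node n) (i) :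
    (children R i : Set (Node (n + 1))).PairwiseDisjoint
      fun R' => Ioo (box R').left (box R').right

namespace BoxTree

variable {r q : ℝ} {K : ℕ} (𝒯 : BoxTree r q K) {n : ℕ}

theorem K_pos (𝒯 : BoxTree r q K) : (0 : ℝ) < K := by
  have := 𝒯.three_le
  positivity

theorem q_pos (𝒯 : BoxTree r q K) : 0 < q := one_pos.trans 𝒯.one_lt

/-- The height of `y` above the lower boundary of `R`, in units of the height of `R`. -/
noncomputable def height (R : 𝒯.Node n) (y : ℝ) : ℝ := y * K ^ n - (𝒯.box R).level

/-- The bump function over row `i` of the children of `R`. It is the function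
`trapezoid r ∘ height R'` of any child `R'` in that row, but is also defined without choosing
such a child. -/
noncomputable def weight (R : 𝒯.Node n) (i : Fin (K + 2 * 𝒯.k)) (y : ℝ) : ℝ :=
  trapezoid r (K * 𝒯.height R y + 3 * 𝒯.k - (i : ℕ))

/-- The open interval of heights `y` over which `trapezoid r ∘ height R` is positive. -/
def activeHeights (R : 𝒯.Node n) : Set ℝ := {y | trapezoid r (𝒯.height R y) ≠ 0}

/-- The union of the extended boxes at scale `n`. -/
def shadow (n : ℕ) : Set (ℝ × ℝ) := ⋃ R : 𝒯.Node n, (𝒯.box R).extended r K n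

/-- The approximations to a devil's staircase in the box `R`. The one of depth `0` climbs from `0`
to `1` over the time interval of `R`; the one of depth `j + 1` climbs, at each height, in equal
shares over the time intervals of the children of `R` in the rows at that height. -/
noncomputable def ladder : ℕ → {n : ℕ} → 𝒯.Node n → ℝ × ℝ → ℝ
  | 0, _, R, z => Real.smoothTransition
      ((z.1 - (𝒯.box R).left) / ((𝒯.box R).right - (𝒯.box R).left))
  | j + 1, _, R, z => ∑ i, 𝒯.weight R i z.2 * 𝔼 R' ∈ 𝒯.children R i, ladder j R' z

variable {𝒯} {R : 𝒯.Node n} {i : Fin (K + 2 * 𝒯.k)} {R' : 𝒯.Node (n + 1)} {j : ℕ} {z : ℝ × ℝ}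
  {y : ℝ}

theorem children_nonempty (R : 𝒯.Node n) (i) : (𝒯.children R i).Nonempty :=
  Finset.card_pos.1 (Nat.cast_pos.1 (𝒯.q_pos.trans_le (𝒯.le_card R i)))

theorem contDiff_height (R : 𝒯.Node n) : ContDiff ℝ ∞ (𝒯.height R) := by
  unfold height; fun_prop

theorem contDiff_weight (R : 𝒯.Node n) (i) : ContDiff ℝ ∞ (𝒯.weight R i) :=
  (contDiff_trapezoid r).comp
    (((contDiff_const.mul (contDiff_height R)).add contDiff_const).sub contDiff_const)

theorem weight_nonneg (R : 𝒯.Node n) (i) (y : ℝ) : 0 ≤ 𝒯.weight R i y :=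
  trapezoid_nonneg 𝒯.r_pos _

theorem sum_weight_le_one (R : 𝒯.Node n) (y : ℝ) : ∑ i, 𝒯.weight R i y ≤ 1 :=
  sum_trapezoid_le_one _ _ _

theorem isOpen_activeHeights (R : 𝒯.Node n) : IsOpen (𝒯.activeHeights R) :=
  isOpen_ne_fun ((contDiff_trapezoid r).comp (contDiff_height R)).continuous continuous_const

theorem weight_eq_of_mem_children (hR' : R' ∈ 𝒯.children R i) :
    𝒯.weight R i y = trapezoid r (𝒯.height R' y) := by
  rw [weight, height, height, 𝒯.level_eq hR']
  push_cast
  ring_nf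

theorem mem_activeHeights_of_mem_children (hR' : R' ∈ 𝒯.children R i)
    (hy : 𝒯.weight R i y ≠ 0) : y ∈ 𝒯.activeHeights R' :=
  fun h => hy ((weight_eq_of_mem_children hR').trans h)

theorem sum_weight_eq_one (hy : y ∈ 𝒯.activeHeights R) : ∑ i, 𝒯.weight R i y = 1 := by
  have hmul := 𝒯.mul_eq
  have hr3 : 3 * r ≤ 𝒯.k := by
    rw [← hmul, mul_comm]
    exact mul_le_mul_of_nonneg_left (mod_cast 𝒯.three_le) 𝒯.r_pos.le
  obtain ⟨hy₁, hy₂⟩ := mem_Ioo_of_trapezoid_ne_zero 𝒯.r_pos hy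
  refine sum_trapezoid_eq_one 𝒯.r_pos ⟨?_, ?_⟩
  · nlinarith [𝒯.r_pos]
  · push_cast
    nlinarith

theorem contDiff_ladder (j : ℕ) (R : 𝒯.Node n) : ContDiff ℝ ∞ (𝒯.ladder j R) := by
  induction j generalizing n with
  | zero => exact Real.smoothTransition.contDiff.comp (by fun_prop)
  | succ j ih =>
    have hsum : 𝒯.ladder (j + 1) R = fun z => ∑ i, 𝒯.weight R i z.2 *
        ((∑ R' ∈ 𝒯.children R i, 𝒯.ladder j R' z) / (𝒯.children R i).card) :=
      funext fun z => by simp only [ladder, Finset.expect_eq_sum_div_card]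
    rw [hsum]
    exact ContDiff.sum fun i _ => ((contDiff_weight R i).comp contDiff_snd).mul
      ((ContDiff.sum fun R' _ => ih R').div_const _)

theorem ladder_mem_Icc (j : ℕ) (R : 𝒯.Node n) (z : ℝ × ℝ) : 𝒯.ladder j R z ∈ Icc 0 1 := by
  induction j generalizing n with
  | zero => exact ⟨Real.smoothTransition.nonneg _, Real.smoothTransition.le_one _⟩
  | succ j ih =>
    have hexp₀ : ∀ i, 0 ≤ 𝔼 R' ∈ 𝒯.children R i, 𝒯.ladder j R' z := fun i =>
      Finset.expect_nonneg fun R' _ => (ih R').1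
    have hexp₁ : ∀ i, 𝔼 R' ∈ 𝒯.children R i, 𝒯.ladder j R' z ≤ 1 := fun i =>
      Finset.expect_le (children_nonempty R i) fun R' _ => (ih R').2
    refine ⟨Finset.sum_nonneg fun i _ => mul_nonneg (weight_nonneg R i _) (hexp₀ i), ?_⟩
    exact (Finset.sum_le_sum fun i _ => mul_le_of_le_one_right (weight_nonneg R i _)
      (hexp₁ i)).trans (sum_weight_le_one R _)

theorem abs_expect_ladder_le_one (j : ℕ) (R : 𝒯.Node n) (i) (z : ℝ × ℝ) :
    |𝔼 R' ∈ 𝒯.children R i, 𝒯.ladder j R' z| ≤ 1 := by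
  rw [abs_of_nonneg (Finset.expect_nonneg fun R' _ => (ladder_mem_Icc j R' z).1)]
  exact Finset.expect_le (children_nonempty R i) fun R' _ => (ladder_mem_Icc j R' z).2

theorem ladder_of_le_left (hz : z.1 ≤ (𝒯.box R).left) : 𝒯.ladder j R z = 0 := by
  induction j generalizing n with
  | zero =>
    exact Real.smoothTransition.zero_of_nonpos (div_nonpos_of_nonpos_of_nonneg (sub_nonpos.2 hz)
      (sub_nonneg.2 (𝒯.left_lt_right R).le))
  | succ j ih =>
    refine Finset.sum_eq_zero fun i _ => ?_
    rw [Finset.expect_eq_zero fun R' hR' => ih (hz.trans (𝒯.left_le hR')), mul_zero]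

theorem ladder_of_right_le (hy : z.2 ∈ 𝒯.activeHeights R) (hz : (𝒯.box R).right ≤ z.1) :
    𝒯.ladder j R z = 1 := by
  induction j generalizing n with
  | zero =>
    exact Real.smoothTransition.one_of_one_le
      ((one_le_div₀ (sub_pos.2 (𝒯.left_lt_right R))).2 (by linarith))
  | succ j ih =>
    refine sum_mul_eq_of_sum_eq_one (sum_weight_eq_one hy) fun i _ hi => ?_
    rw [Finset.expect_congr rfl fun R' hR' => ih (mem_activeHeights_of_mem_children hR' hi)
      ((𝒯.right_le hR').trans hz), Finset.expect_const (children_nonempty R i)]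

theorem ladder_eq_of_notMem_Ioo (hy : z.2 ∈ 𝒯.activeHeights R)
    (hz : z.1 ∉ Ioo (𝒯.box R).left (𝒯.box R).right) (j j' : ℕ) :
    𝒯.ladder j R z = 𝒯.ladder j' R z := by
  rw [mem_Ioo, not_and_or, not_lt, not_lt] at hz
  rcases hz with h | h
  · rw [ladder_of_le_left h, ladder_of_le_left h]
  · rw [ladder_of_right_le hy h, ladder_of_right_le hy h]

theorem ladder_succ_sub (i j : ℕ) (R : 𝒯.Node n) (z : ℝ × ℝ) :
    𝒯.ladder (i + 1) R z - 𝒯.ladder (j + 1) R z =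
      ∑ l, 𝒯.weight R l z.2 *
        𝔼 R' ∈ 𝒯.children R l, (𝒯.ladder i R' z - 𝒯.ladder j R' z) := by
  simp only [ladder, Finset.expect_sub_distrib, mul_sub, Finset.sum_sub_distrib]

theorem abs_ladder_succ_sub_le (hy : z.2 ∈ 𝒯.activeHeights R) (j : ℕ) :
    |𝒯.ladder (j + 1) R z - 𝒯.ladder j R z| ≤ q⁻¹ ^ j := by
  have hq := 𝒯.q_pos
  induction j generalizing n with
  | zero =>
    have h₀ := ladder_mem_Icc 0 R z
    have h₁ := ladder_mem_Icc 1 R z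
    rw [pow_zero]
    exact (abs_sub_le_of_le_of_le h₁.1 h₁.2 h₀.1 h₀.2).trans_eq (sub_zero 1)
  | succ j ih =>
    rw [ladder_succ_sub]
    refine abs_sum_mul_le_of_sum_le_one (fun i _ => weight_nonneg R i _) (sum_weight_le_one R _)
      (by positivity) fun i _ hi => ?_
    rw [pow_succ']
    exact abs_expect_le_of_pairwiseDisjoint (x := z.1) hq (𝒯.le_card R i)
      (𝒯.pairwiseDisjoint R i) (by positivity)
      (fun R' hR' hz => sub_eq_zero.2
        (ladder_eq_of_notMem_Ioo (mem_activeHeights_of_mem_children hR' hi) hz _ _))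
      (fun R' hR' _ => ih (mem_activeHeights_of_mem_children hR' hi))

theorem mem_shadow (hy : z.2 ∈ 𝒯.activeHeights R)
    (hz : z.1 ∈ Icc (𝒯.box R).left (𝒯.box R).right) : z ∈ 𝒯.shadow n := by
  have hK := 𝒯.K_pos
  obtain ⟨hy₁, hy₂⟩ := mem_Ioo_of_trapezoid_ne_zero 𝒯.r_pos hy
  rw [height] at hy₁ hy₂
  refine mem_iUnion.2 ⟨R, hz, ?_, ?_⟩
  · rw [mesh, ← div_eq_mul_inv, div_le_iff₀ (by positivity)]
    linarith
  · rw [mesh, ← div_eq_mul_inv, le_div_iff₀ (by positivity)]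
    linarith [𝒯.r_pos]

theorem ladder_succ_eq_of_notMem_shadow {i j : ℕ} (hij : i ≤ j)
    (hy : z.2 ∈ 𝒯.activeHeights R) (hz : z ∉ 𝒯.shadow (n + i)) :
    𝒯.ladder (j + 1) R z = 𝒯.ladder j R z := by
  induction i generalizing n j with
  | zero =>
    exact ladder_eq_of_notMem_Ioo hy (fun h => hz (mem_shadow hy (Ioo_subset_Icc_self h))) _ _
  | succ i ih =>
    obtain ⟨j, rfl⟩ := Nat.exists_eq_add_of_le' (Nat.one_le_of_lt hij)
    rw [← sub_eq_zero, ladder_succ_sub]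
    refine Finset.sum_eq_zero fun l _ => mul_eq_zero.2 (or_iff_not_imp_left.2 fun hl => ?_)
    refine Finset.expect_eq_zero fun R' hR' => sub_eq_zero.2 ?_
    exact ih (Nat.le_of_succ_le_succ hij) (mem_activeHeights_of_mem_children hR' hl)
      (by rwa [add_right_comm, add_assoc])

theorem eventually_ladder_eq_of_notMem_shadow (hy : z.2 ∈ 𝒯.activeHeights R)
    (hz : z ∉ 𝒯.shadow (n + j)) :
    ∀ᶠ x in 𝓝 z.1, 𝒯.ladder j R (x, z.2) = 𝒯.ladder j R z := by
  induction j generalizing n with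
  | zero =>
    have hz' : z.1 ∉ Icc (𝒯.box R).left (𝒯.box R).right := fun h => hz (mem_shadow hy h)
    rw [mem_Icc, not_and_or, not_le, not_le] at hz'
    rcases hz' with h | h
    · filter_upwards [gt_mem_nhds h] with x hx
      rw [ladder_of_le_left h.le, ladder_of_le_left hx.le]
    · filter_upwards [lt_mem_nhds h] with x hx
      rw [ladder_of_right_le hy h.le, ladder_of_right_le (z := (x, z.2)) hy hx.le]
  | succ j ih =>
    have hchild : ∀ᶠ x in 𝓝 z.1, ∀ i, 𝒯.weight R i z.2 ≠ 0 → ∀ R' ∈ 𝒯.children R i,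
        𝒯.ladder j R' (x, z.2) = 𝒯.ladder j R' z := by
      refine eventually_all.2 fun i => eventually_imp_distrib_left.2 fun hi =>
        (Finset.eventually_all _).2 fun R' hR' => ?_
      exact ih (mem_activeHeights_of_mem_children hR' hi) (by rwa [add_right_comm, add_assoc])
    filter_upwards [hchild] with x hx
    refine Finset.sum_congr rfl fun i _ => ?_
    rcases eq_or_ne (𝒯.weight R i z.2) 0 with hi | hi
    · simp [hi]
    · rw [Finset.expect_congr rfl (hx i hi)]

section VerticalDerivative

variable {D x y : ℝ}

theorem abs_deriv_trapezoid_height_le (hD : ∀ t, |deriv (trapezoid r) t| ≤ D) (R : 𝒯.Node n)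
    (y : ℝ) : |deriv (fun y => trapezoid r (𝒯.height R y)) y| ≤ D * K ^ n := by
  have hheight : HasDerivAt (𝒯.height R) (1 * (K : ℝ) ^ n) y :=
    ((hasDerivAt_id y).mul_const _).sub_const _
  have htrap := ((contDiff_trapezoid r).differentiable (by simp) (𝒯.height R y)).hasDerivAt
  have hcomp : HasDerivAt (fun y => trapezoid r (𝒯.height R y)) _ y := htrap.comp y hheight
  rw [hcomp.deriv, one_mul, abs_mul, abs_pow, Nat.abs_cast]
  gcongr
  exact hD _

theorem abs_deriv_weight_le (hD : ∀ t, |deriv (trapezoid r) t| ≤ D) (R : 𝒯.Node n) (i) (y : ℝ) :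
    |deriv (𝒯.weight R i) y| ≤ D * K ^ (n + 1) := by
  obtain ⟨R', hR'⟩ := children_nonempty R i
  have hweight : 𝒯.weight R i = fun y => trapezoid r (𝒯.height R' y) :=
    funext fun _ => weight_eq_of_mem_children hR'
  exact hweight ▸ abs_deriv_trapezoid_height_le hD R' y

theorem hasDerivAt_ladder (j : ℕ) (R : 𝒯.Node n) (x y : ℝ) :
    HasDerivAt (fun y => 𝒯.ladder j R (x, y)) (deriv (fun y => 𝒯.ladder j R (x, y)) y) y :=
  (((contDiff_ladder j R).differentiable (by simp)).comp
    (differentiable_const x |>.prodMk differentiable_id) y).hasDerivAt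

theorem deriv_ladder_succ (j : ℕ) (R : 𝒯.Node n) (x y : ℝ) :
    deriv (fun y => 𝒯.ladder (j + 1) R (x, y)) y =
      ∑ i, deriv (𝒯.weight R i) y * 𝔼 R' ∈ 𝒯.children R i, 𝒯.ladder j R' (x, y) +
      ∑ i, 𝒯.weight R i y *
        𝔼 R' ∈ 𝒯.children R i, deriv (fun y => 𝒯.ladder j R' (x, y)) y := by
  rw [← Finset.sum_add_distrib]
  refine HasDerivAt.deriv (HasDerivAt.fun_sum fun i _ => ?_)
  simp only [Finset.expect_eq_sum_div_card]
  exact ((contDiff_weight R i).differentiable (by simp) y).hasDerivAt.mul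
    ((HasDerivAt.fun_sum fun R' _ => hasDerivAt_ladder j R' x y).div_const _)

theorem deriv_ladder_eq_zero_of_notMem_Ioo (hy : y ∈ 𝒯.activeHeights R)
    (hx : x ∉ Ioo (𝒯.box R).left (𝒯.box R).right) (j : ℕ) :
    deriv (fun y => 𝒯.ladder j R (x, y)) y = 0 := by
  have hconst : (fun y => 𝒯.ladder j R (x, y)) =ᶠ[𝓝 y] fun _ => 𝒯.ladder 0 R (x, y) := by
    filter_upwards [(isOpen_activeHeights R).mem_nhds hy] with y' hy'
    exact ladder_eq_of_notMem_Ioo (z := (x, y')) hy' hx j 0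
  rw [hconst.deriv_eq, deriv_const]

theorem abs_sum_deriv_weight_mul_le (hD : ∀ t, |deriv (trapezoid r) t| ≤ D) (R : 𝒯.Node n)
    (y : ℝ) {a : Fin (K + 2 * 𝒯.k) → ℝ} (ha : ∀ i, |a i| ≤ 1) :
    |∑ i, deriv (𝒯.weight R i) y * a i| ≤ (K + 2 * 𝒯.k) * D * K ^ (n + 1) :=
  calc |∑ i, deriv (𝒯.weight R i) y * a i|
      ≤ ∑ i, |deriv (𝒯.weight R i) y * a i| := Finset.abs_sum_le_sum_abs _ _
    _ ≤ ∑ _i : Fin (K + 2 * 𝒯.k), D * K ^ (n + 1) := by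
        refine Finset.sum_le_sum fun i _ => ?_
        rw [abs_mul]
        exact (mul_le_of_le_one_right (abs_nonneg _) (ha i)).trans (abs_deriv_weight_le hD R i y)
    _ = (K + 2 * 𝒯.k) * D * K ^ (n + 1) := by
        simp only [Finset.sum_const, Finset.card_univ, Fintype.card_fin, nsmul_eq_mul]
        push_cast
        ring

theorem abs_deriv_ladder_le (hD : ∀ t, |deriv (trapezoid r) t| ≤ D)
    (hy : y ∈ 𝒯.activeHeights R) (x : ℝ) (j : ℕ) :
    |deriv (fun y => 𝒯.ladder j R (x, y)) y| ≤ ∑ i ∈ Finset.range j,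
      (𝒯.shadow (n + i)).indicator (fun _ => (K + 2 * 𝒯.k) * D * K ^ (n + 1) * (K / q) ^ i)
        (x, y) := by
  have hD₀ : 0 ≤ D := (abs_nonneg _).trans (hD 0)
  have hq := 𝒯.q_pos
  have hterm : ∀ n i : ℕ, 0 ≤ (K + 2 * 𝒯.k) * D * K ^ (n + 1) * (K / q) ^ i := fun n i => by
    positivity
  induction j generalizing n with
  | zero => simp [ladder]
  | succ j ih =>
    by_cases hx : x ∈ Ioo (𝒯.box R).left (𝒯.box R).right
    · set b := ∑ i ∈ Finset.range j, (𝒯.shadow (n + 1 + i)).indicator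
        (fun _ => (K + 2 * 𝒯.k) * D * K ^ (n + 1 + 1) * (K / q) ^ i) (x, y) with hb
      have hb₀ : 0 ≤ b :=
        Finset.sum_nonneg fun i _ => indicator_nonneg (fun _ _ => hterm (n + 1) i) _
      have hladders : |∑ i, 𝒯.weight R i y *
          𝔼 R' ∈ 𝒯.children R i, deriv (fun y => 𝒯.ladder j R' (x, y)) y| ≤ q⁻¹ * b := by
        refine abs_sum_mul_le_of_sum_le_one (fun i _ => weight_nonneg R i _)
          (sum_weight_le_one R _) (by positivity) fun i _ hi => ?_
        exact abs_expect_le_of_pairwiseDisjoint hq (𝒯.le_card R i) (𝒯.pairwiseDisjoint R i) hb₀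
          (fun R' hR' hx' => deriv_ladder_eq_zero_of_notMem_Ioo
            (mem_activeHeights_of_mem_children hR' hi) hx' j)
          (fun R' hR' _ => ih (mem_activeHeights_of_mem_children hR' hi))
      have hweights := abs_sum_deriv_weight_mul_le hD R y
        (a := fun i => 𝔼 R' ∈ 𝒯.children R i, 𝒯.ladder j R' (x, y)) fun i =>
          abs_expect_ladder_le_one j R i (x, y)
      have hscale : q⁻¹ * b = ∑ i ∈ Finset.range j, (𝒯.shadow (n + (i + 1))).indicator
          (fun _ => (K + 2 * 𝒯.k) * D * K ^ (n + 1) * (K / q) ^ (i + 1)) (x, y) := by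
        rw [hb, Finset.mul_sum]
        refine Finset.sum_congr rfl fun i _ => ?_
        rw [← indicator_const_mul, add_right_comm, add_assoc n]
        congr! 2
        ring
      rw [deriv_ladder_succ, Finset.sum_range_succ', ← hscale, add_zero,
        indicator_of_mem (mem_shadow hy (Ioo_subset_Icc_self hx)), pow_zero, mul_one, add_comm]
      exact (abs_add_le _ _).trans (add_le_add hladders hweights)
    · rw [deriv_ladder_eq_zero_of_notMem_Ioo hy hx, abs_zero]
      exact Finset.sum_nonneg fun i _ => indicator_nonneg (fun _ _ => hterm n i) _

end VerticalDerivative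

end BoxTree

theorem exists_continuous_tendsto_of_le_geometric {X : Type*} [TopologicalSpace X]
    {g : ℕ → X → ℝ} {ρ : ℝ} (hρ₀ : 0 ≤ ρ) (hρ₁ : ρ < 1) (hg : ∀ j, Continuous (g j))
    (hgρ : ∀ j z, |g (j + 1) z - g j z| ≤ ρ ^ j) :
    ∃ f : X → ℝ, Continuous f ∧ ∀ z, Tendsto (fun j => g j z) atTop (𝓝 (f z)) := by
  have hdist : ∀ z j, dist (g j z) (g (j + 1) z) ≤ 1 * ρ ^ j := fun z j => by
    rw [one_mul, dist_comm, Real.dist_eq]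
    exact hgρ j z
  choose f hf using fun z =>
    cauchySeq_tendsto_of_complete (cauchySeq_of_le_geometric ρ 1 hρ₁ (hdist z))
  have hzero : Tendsto (fun j => 1 * ρ ^ j / (1 - ρ)) atTop (𝓝 0) := by
    simpa using ((tendsto_pow_atTop_nhds_zero_of_lt_one hρ₀ hρ₁).const_mul 1).div_const (1 - ρ)
  have hunif : TendstoUniformly g f atTop := Metric.tendstoUniformly_iff.2 fun ε hε => by
    filter_upwards [hzero.eventually_lt_const hε] with j hj z
    rw [dist_comm]
    exact (dist_le_of_le_geometric_of_tendsto ρ 1 hρ₁ (hdist z) (hf z) j).trans_lt hj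
  exact ⟨f, hunif.continuous (Frequently.of_forall hg), hf⟩

theorem hasDerivAt_slice_horizontal {f : ℝ × ℝ → ℝ} {z : ℝ × ℝ} (hf : DifferentiableAt ℝ f z) :
    HasDerivAt (fun x => f (x, z.2)) (fderiv ℝ f z (1, 0)) z.1 :=
  hf.hasFDerivAt.comp_hasDerivAt z.1 ((hasDerivAt_id z.1).prodMk (hasDerivAt_const z.1 z.2))

theorem hasDerivAt_slice_vertical {f : ℝ × ℝ → ℝ} {z : ℝ × ℝ} (hf : DifferentiableAt ℝ f z) :
    HasDerivAt (fun y => f (z.1, y)) (fderiv ℝ f z (0, 1)) z.2 :=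
  hf.hasFDerivAt.comp_hasDerivAt z.2 ((hasDerivAt_const z.2 z.1).prodMk (hasDerivAt_id z.2))

namespace BoxTree

section Staircase

variable {r q : ℝ} {K : ℕ} (𝒯 : BoxTree r q K)

/-- A smooth cutoff to the right of the root, equal to `1` up to its right boundary. -/
noncomputable def cutoff (x : ℝ) : ℝ := Real.smoothTransition ((𝒯.box 𝒯.root).right + 1 - x)

/-- The vertical profile of the staircase, which it attains to the right of the root. -/
noncomputable def profile (y : ℝ) : ℝ := trapezoid r (𝒯.height 𝒯.root y)

/-- A compact rectangle containing the supports of all staircases. -/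
def frame : Set (ℝ × ℝ) :=
  Icc (𝒯.box 𝒯.root).left ((𝒯.box 𝒯.root).right + 1) ×ˢ
    Icc ((𝒯.box 𝒯.root).level - 3 * r) ((𝒯.box 𝒯.root).level + 1)

/-- The compactly supported approximation of depth `j` to the function that witnesses
non-removability. -/
noncomputable def staircase (j : ℕ) (z : ℝ × ℝ) : ℝ :=
  𝒯.cutoff z.1 * (𝒯.profile z.2 * 𝒯.ladder j 𝒯.root z)

variable {𝒯} {z : ℝ × ℝ} {x y : ℝ}

theorem contDiff_cutoff : ContDiff ℝ ∞ 𝒯.cutoff :=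
  Real.smoothTransition.contDiff.comp (contDiff_const.sub contDiff_id)

theorem contDiff_profile : ContDiff ℝ ∞ 𝒯.profile :=
  (contDiff_trapezoid r).comp (contDiff_height 𝒯.root)

theorem cutoff_mem_Icc (x : ℝ) : 𝒯.cutoff x ∈ Icc 0 1 :=
  ⟨Real.smoothTransition.nonneg _, Real.smoothTransition.le_one _⟩

theorem profile_mem_Icc (y : ℝ) : 𝒯.profile y ∈ Icc 0 1 :=
  ⟨trapezoid_nonneg 𝒯.r_pos _, trapezoid_le_one _ _⟩

theorem cutoff_of_le (hx : x ≤ (𝒯.box 𝒯.root).right) : 𝒯.cutoff x = 1 :=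
  Real.smoothTransition.one_of_one_le (by linarith)

theorem cutoff_of_ge (hx : (𝒯.box 𝒯.root).right + 1 ≤ x) : 𝒯.cutoff x = 0 :=
  Real.smoothTransition.zero_of_nonpos (by linarith)

theorem hasDerivAt_cutoff (x : ℝ) : HasDerivAt 𝒯.cutoff (deriv 𝒯.cutoff x) x :=
  (contDiff_cutoff.differentiable (by simp) x).hasDerivAt

theorem hasDerivAt_profile (y : ℝ) : HasDerivAt 𝒯.profile (deriv 𝒯.profile y) y :=
  (contDiff_profile.differentiable (by simp) y).hasDerivAt

theorem deriv_cutoff_of_le (hx : x ≤ (𝒯.box 𝒯.root).right) : deriv 𝒯.cutoff x = 0 :=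
  IsLocalMax.deriv_eq_zero (Eventually.of_forall fun x' =>
    (cutoff_mem_Icc x').2.trans_eq (cutoff_of_le hx).symm)

theorem deriv_cutoff_of_ge (hx : (𝒯.box 𝒯.root).right + 1 ≤ x) : deriv 𝒯.cutoff x = 0 :=
  IsLocalMin.deriv_eq_zero (Eventually.of_forall fun x' =>
    (cutoff_of_ge hx).trans_le (cutoff_mem_Icc x').1)

theorem hasCompactSupport_deriv_cutoff : HasCompactSupport (deriv 𝒯.cutoff) :=
  HasCompactSupport.intro (isCompact_Icc (a := (𝒯.box 𝒯.root).right)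
    (b := (𝒯.box 𝒯.root).right + 1)) fun x hx => by
      rw [mem_Icc, not_and_or, not_le, not_le] at hx
      exact hx.elim (deriv_cutoff_of_le ·.le) (deriv_cutoff_of_ge ·.le)

theorem profile_eq_zero_of_notMem
    (hy : y ∉ Icc ((𝒯.box 𝒯.root).level - 3 * r) ((𝒯.box 𝒯.root).level + 1)) :
    𝒯.profile y = 0 := by
  by_contra h
  obtain ⟨h₁, h₂⟩ := mem_Ioo_of_trapezoid_ne_zero 𝒯.r_pos h
  rw [height, pow_zero, mul_one] at h₁ h₂
  exact hy ⟨by linarith, by linarith [𝒯.r_pos]⟩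

theorem hasCompactSupport_profile : HasCompactSupport 𝒯.profile :=
  HasCompactSupport.intro isCompact_Icc fun _ => profile_eq_zero_of_notMem

theorem integral_profile_pos : 0 < ∫ y, 𝒯.profile y := by
  simp only [profile, height, pow_zero, mul_one]
  rw [integral_sub_right_eq_self (trapezoid r)]
  exact integral_trapezoid_pos 𝒯.r_pos

theorem integral_deriv_cutoff : ∫ x, deriv 𝒯.cutoff x = -1 := by
  have hleft : Tendsto 𝒯.cutoff atBot (𝓝 1) := tendsto_const_nhds.congr' <|
    (eventually_le_atBot _).mono fun x hx => (cutoff_of_le hx).symm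
  have hright : Tendsto 𝒯.cutoff atTop (𝓝 0) := tendsto_const_nhds.congr' <|
    (eventually_ge_atTop _).mono fun x hx => (cutoff_of_ge hx).symm
  have hint : Integrable (deriv 𝒯.cutoff) :=
    (contDiff_cutoff.continuous_deriv (by simp)).integrable_of_hasCompactSupport
      hasCompactSupport_deriv_cutoff
  rw [integral_of_hasDerivAt_of_tendsto hasDerivAt_cutoff hint hleft hright, zero_sub]

theorem isCompact_frame : IsCompact 𝒯.frame := isCompact_Icc.prod isCompact_Icc

theorem contDiff_staircase (j : ℕ) : ContDiff ℝ ∞ (𝒯.staircase j) :=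
  (contDiff_cutoff.comp contDiff_fst).mul
    ((contDiff_profile.comp contDiff_snd).mul (contDiff_ladder j 𝒯.root))

theorem staircase_eq_zero_of_notMem_frame (hz : z ∉ 𝒯.frame) (j : ℕ) : 𝒯.staircase j z = 0 := by
  rw [frame, mem_prod, not_and_or, mem_Icc, not_and_or, not_le, not_le] at hz
  rcases hz with (hz | hz) | hz
  · rw [staircase, ladder_of_le_left hz.le, mul_zero, mul_zero]
  · rw [staircase, cutoff_of_ge hz.le, zero_mul]
  · rw [staircase, profile_eq_zero_of_notMem hz, zero_mul, mul_zero]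

theorem abs_staircase_succ_sub_le (j : ℕ) (z : ℝ × ℝ) :
    |𝒯.staircase (j + 1) z - 𝒯.staircase j z| ≤ q⁻¹ ^ j := by
  have hq := 𝒯.q_pos
  have hprofile : |𝒯.profile z.2 * (𝒯.ladder (j + 1) 𝒯.root z - 𝒯.ladder j 𝒯.root z)| ≤
      q⁻¹ ^ j := by
    rcases eq_or_ne (𝒯.profile z.2) 0 with hy | hy
    · rw [hy, zero_mul, abs_zero]
      positivity
    · rw [abs_mul, abs_of_nonneg (profile_mem_Icc _).1]
      exact (mul_le_of_le_one_left (abs_nonneg _) (profile_mem_Icc _).2).trans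
        (abs_ladder_succ_sub_le hy j)
  rw [staircase, staircase, ← mul_sub, ← mul_sub, abs_mul, abs_of_nonneg (cutoff_mem_Icc _).1]
  exact (mul_le_of_le_one_left (abs_nonneg _) (cutoff_mem_Icc _).2).trans hprofile

theorem staircase_eq_of_notMem_shadow {i j : ℕ} (hij : i ≤ j) (hz : z ∉ 𝒯.shadow i) :
    𝒯.staircase j z = 𝒯.staircase i z := by
  induction j, hij using Nat.le_induction with
  | base => rfl
  | succ j hij ih =>
    rw [← ih, staircase, staircase]
    rcases eq_or_ne (𝒯.profile z.2) 0 with hy | hy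
    · simp only [hy, zero_mul]
    · rw [ladder_succ_eq_of_notMem_shadow (R := 𝒯.root) hij hy (by rwa [zero_add])]

theorem fderiv_staircase_horizontal {j : ℕ} (hz : z ∉ 𝒯.shadow j) :
    fderiv ℝ (𝒯.staircase j) z (1, 0) = deriv 𝒯.cutoff z.1 * 𝒯.profile z.2 := by
  refine (hasDerivAt_slice_horizontal
    ((contDiff_staircase j).differentiable (by simp) z)).unique ?_
  rcases eq_or_ne (𝒯.profile z.2) 0 with hy | hy
  · simpa only [staircase, hy, zero_mul, mul_zero] using hasDerivAt_const z.1 (0 : ℝ)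
  have hladder : deriv 𝒯.cutoff z.1 * 𝒯.ladder j 𝒯.root z = deriv 𝒯.cutoff z.1 := by
    rcases le_total z.1 (𝒯.box 𝒯.root).right with hx | hx
    · rw [deriv_cutoff_of_le hx, zero_mul]
    · rw [ladder_of_right_le hy hx, mul_one]
  have hderiv := (𝒯.hasDerivAt_cutoff z.1).mul_const
    (𝒯.profile z.2 * 𝒯.ladder j 𝒯.root z)
  rw [mul_left_comm, hladder, mul_comm (𝒯.profile z.2) (deriv _ _)] at hderiv
  refine hderiv.congr_of_eventuallyEq ?_
  filter_upwards [eventually_ladder_eq_of_notMem_shadow (R := 𝒯.root) (z := z) hy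
    (by rwa [zero_add])] with x hx
  rw [staircase, hx]

theorem fderiv_staircase_vertical (j : ℕ) (z : ℝ × ℝ) :
    fderiv ℝ (𝒯.staircase j) z (0, 1) = 𝒯.cutoff z.1 *
      (deriv 𝒯.profile z.2 * 𝒯.ladder j 𝒯.root z +
        𝒯.profile z.2 * deriv (fun y => 𝒯.ladder j 𝒯.root (z.1, y)) z.2) :=
  (hasDerivAt_slice_vertical ((contDiff_staircase j).differentiable (by simp) z)).unique
    (((hasDerivAt_profile z.2).fun_mul (hasDerivAt_ladder j 𝒯.root z.1 z.2)).const_mul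
      (𝒯.cutoff z.1))

theorem abs_fderiv_staircase_vertical_le {D : ℝ} (hD : ∀ t, |deriv (trapezoid r) t| ≤ D)
    (j : ℕ) (z : ℝ × ℝ) :
    |fderiv ℝ (𝒯.staircase j) z (0, 1)| ≤ 𝒯.frame.indicator (fun _ => D) z +
      ∑ i ∈ Finset.range j,
        (𝒯.shadow i).indicator (fun _ => (K + 2 * 𝒯.k) * D * K * (K / q) ^ i) z := by
  have hD₀ : 0 ≤ D := (abs_nonneg _).trans (hD 0)
  have hq := 𝒯.q_pos
  set b := ∑ i ∈ Finset.range j,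
    (𝒯.shadow i).indicator (fun _ => (K + 2 * 𝒯.k) * D * K * (K / q) ^ i) z
  have hb₀ : 0 ≤ b := Finset.sum_nonneg fun i _ => indicator_nonneg (fun _ _ => by positivity) _
  by_cases hz : z ∈ 𝒯.frame
  swap
  · have hnhds : 𝒯.staircase j =ᶠ[𝓝 z] fun _ => 0 := by
      filter_upwards [isCompact_frame.isClosed.isOpen_compl.mem_nhds hz] with w hw
      exact staircase_eq_zero_of_notMem_frame hw j
    rw [hnhds.fderiv_eq, indicator_of_notMem hz, zero_add]
    simpa using hb₀
  have hprofile : |deriv 𝒯.profile z.2 * 𝒯.ladder j 𝒯.root z| ≤ D := by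
    have hbound := abs_deriv_trapezoid_height_le hD 𝒯.root z.2
    rw [pow_zero, mul_one] at hbound
    have hladder := ladder_mem_Icc j 𝒯.root z
    rw [abs_mul, abs_of_nonneg hladder.1]
    exact (mul_le_of_le_one_right (abs_nonneg _) hladder.2).trans hbound
  have hladder : |𝒯.profile z.2 * deriv (fun y => 𝒯.ladder j 𝒯.root (z.1, y)) z.2| ≤ b := by
    rcases eq_or_ne (𝒯.profile z.2) 0 with hy | hy
    · rwa [hy, zero_mul, abs_zero]
    rw [abs_mul, abs_of_nonneg (profile_mem_Icc _).1]
    refine (mul_le_of_le_one_left (abs_nonneg _) (profile_mem_Icc _).2).trans ?_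
    simpa only [zero_add, pow_one] using abs_deriv_ladder_le hD hy z.1 j
  rw [fderiv_staircase_vertical, indicator_of_mem hz, abs_mul, abs_of_nonneg (cutoff_mem_Icc _).1]
  exact (mul_le_of_le_one_left (abs_nonneg _) (cutoff_mem_Icc _).2).trans
    ((abs_add_le _ _).trans (add_le_add hprofile hladder))

end Staircase
end BoxTree

/-! ### Integrability of the vertical derivative -/

section Lp

variable {α : Type*} [MeasurableSpace α] {μ : Measure α}

theorem memLp_tsum_norm {E : Type*} [NormedAddCommGroup E] {p : ℝ≥0∞} (hp : 1 ≤ p)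
    {u : ℕ → α → E} (hu : ∀ i, AEStronglyMeasurable (u i) μ)
    (hsum : ∑' i, eLpNorm (u i) p μ ≠ ⊤) : MemLp (fun z => ∑' i, ‖u i z‖) p μ := by
  have hmeas : ∀ j, AEStronglyMeasurable (fun z => ∑ i ∈ Finset.range j, ‖u i z‖) μ := fun j =>
    Finset.aestronglyMeasurable_fun_sum _ fun i _ => (hu i).norm
  have htendsto : ∀ᵐ z ∂μ, Tendsto (fun j => ∑ i ∈ Finset.range j, ‖u i z‖) atTop
      (𝓝 (∑' i, ‖u i z‖)) := by
    filter_upwards [summable_norm_of_tsum_eLpNorm_ne_top hp hu hsum] with z hz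
    exact hz.hasSum.tendsto_sum_nat
  have hpartial : ∀ j, eLpNorm (fun z => ∑ i ∈ Finset.range j, ‖u i z‖) p μ ≤
      ∑' i, eLpNorm (u i) p μ := fun j =>
    calc eLpNorm (fun z => ∑ i ∈ Finset.range j, ‖u i z‖) p μ
        ≤ ∑ i ∈ Finset.range j, eLpNorm (fun z => ‖u i z‖) p μ := by
          rw [← Finset.sum_fn]
          exact eLpNorm_sum_le (fun i _ => (hu i).norm) hp
      _ = ∑ i ∈ Finset.range j, eLpNorm (u i) p μ := by simp only [eLpNorm_norm]
      _ ≤ ∑' i, eLpNorm (u i) p μ := ENNReal.sum_le_tsum _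
  refine ⟨aestronglyMeasurable_of_tendsto_ae atTop hmeas htendsto, ?_⟩
  refine (Lp.eLpNorm_lim_le_liminf_eLpNorm hmeas _ htendsto).trans_lt ?_
  exact (liminf_le_of_le (by isBoundedDefault) fun b hb =>
    let ⟨j, hj⟩ := hb.exists; hj.trans (hpartial j)).trans_lt hsum.lt_top

theorem memLp_of_abs_le_add_sum {p : ℝ≥0∞} (hp : 1 ≤ p) {g h : α → ℝ} {u : ℕ → α → ℝ}
    (hg : AEStronglyMeasurable g μ) (hh : MemLp h p μ) (hu : ∀ i, AEStronglyMeasurable (u i) μ)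
    (hsum : ∑' i, eLpNorm (u i) p μ ≠ ⊤)
    (hbound : ∀ᵐ z ∂μ, ∃ j, |g z| ≤ h z + ∑ i ∈ Finset.range j, u i z) : MemLp g p μ := by
  refine (hh.add (memLp_tsum_norm hp hu hsum)).mono' hg ?_
  filter_upwards [hbound, summable_norm_of_tsum_eLpNorm_ne_top hp hu hsum] with z ⟨j, hj⟩ hz
  refine hj.trans (add_le_add_right ?_ _)
  exact (Finset.sum_le_sum fun i _ => Real.le_norm_self _).trans
    (hz.sum_le_tsum _ fun i _ => norm_nonneg _)

theorem tsum_eLpNorm_indicator_geometric_ne_top {p C ρ : ℝ} {A κ : ℝ≥0∞} {T : ℕ → Set α}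
    (hp : 0 < p) (hA : A ≠ ⊤) (hρκ : ‖ρ‖ₑ ^ p * κ < 1) (hT : ∀ i, μ (T i) ≤ A * κ ^ i) :
    ∑' i, eLpNorm ((T i).indicator fun _ => C * ρ ^ i) (ENNReal.ofReal p) μ ≠ ⊤ := by
  have hratio : ‖ρ‖ₑ * κ ^ (1 / p) < 1 := by
    rw [← ENNReal.rpow_lt_rpow_iff hp, ENNReal.mul_rpow_of_nonneg _ _ hp.le, ← ENNReal.rpow_mul,
      one_div_mul_cancel hp.ne', ENNReal.rpow_one, ENNReal.one_rpow]
    exact hρκ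
  have hterm : ∀ i, eLpNorm ((T i).indicator fun _ => C * ρ ^ i) (ENNReal.ofReal p) μ ≤
      ‖C‖ₑ * A ^ (1 / p) * (‖ρ‖ₑ * κ ^ (1 / p)) ^ i := fun i =>
    calc eLpNorm ((T i).indicator fun _ => C * ρ ^ i) (ENNReal.ofReal p) μ
        ≤ ‖C * ρ ^ i‖ₑ * μ (T i) ^ (1 / p) := by
          simpa only [ENNReal.toReal_ofReal hp.le] using
            eLpNorm_indicator_const_le (C * ρ ^ i) (ENNReal.ofReal p) (s := T i) (μ := μ)
      _ ≤ ‖C * ρ ^ i‖ₑ * (A * κ ^ i) ^ (1 / p) := by gcongr; exact hT i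
      _ = ‖C‖ₑ * A ^ (1 / p) * (‖ρ‖ₑ * κ ^ (1 / p)) ^ i := by
          rw [enorm_mul, enorm_pow, ENNReal.mul_rpow_of_nonneg _ _ (by positivity),
            ← ENNReal.rpow_natCast κ, ← ENNReal.rpow_mul, mul_comm (i : ℝ), ENNReal.rpow_mul,
            ENNReal.rpow_natCast, mul_pow, mul_mul_mul_comm]
  refine ne_top_of_le_ne_top ?_ (ENNReal.tsum_le_tsum hterm)
  rw [ENNReal.tsum_mul_left, ENNReal.tsum_geometric]
  refine ENNReal.mul_ne_top (ENNReal.mul_ne_top enorm_ne_top ?_)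
    (ENNReal.inv_ne_top.2 (tsub_pos_of_lt hratio).ne')
  exact ENNReal.rpow_ne_top_of_nonneg (by positivity) hA

end Lp

namespace BoxTree

variable {r q : ℝ} {K : ℕ} {𝒯 : BoxTree r q K}

theorem eventuallyEq_staircase {f : ℝ × ℝ → ℝ} {z : ℝ × ℝ} {j : ℕ}
    (hclosed : IsClosed (𝒯.shadow j))
    (hlim : ∀ z, Tendsto (fun j => 𝒯.staircase j z) atTop (𝓝 (f z))) (hz : z ∉ 𝒯.shadow j) :
    f =ᶠ[𝓝 z] 𝒯.staircase j := by
  filter_upwards [hclosed.isOpen_compl.mem_nhds hz] with w hw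
  refine tendsto_nhds_unique (hlim w) (tendsto_const_nhds.congr' ?_)
  filter_upwards [eventually_ge_atTop j] with i hi
  exact (staircase_eq_of_notMem_shadow hi hw).symm

theorem integral_deriv_cutoff_mul_profile_neg :
    ∫ z : ℝ × ℝ, deriv 𝒯.cutoff z.1 * 𝒯.profile z.2 < 0 := by
  rw [Measure.volume_eq_prod, integral_prod_mul (deriv 𝒯.cutoff) 𝒯.profile,
    integral_deriv_cutoff, neg_one_mul, neg_lt_zero]
  exact integral_profile_pos

theorem memLp_deriv_cutoff_mul_profile (p : ℝ≥0∞) :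
    MemLp (fun z : ℝ × ℝ => deriv 𝒯.cutoff z.1 * 𝒯.profile z.2) p := by
  refine Continuous.memLp_of_hasCompactSupport ?_ (HasCompactSupport.intro
    (𝒯.hasCompactSupport_deriv_cutoff.isCompact.prod 𝒯.hasCompactSupport_profile.isCompact)
    fun z hz => ?_)
  · exact ((contDiff_cutoff.continuous_deriv (by simp)).comp continuous_fst).mul
      (contDiff_profile.continuous.comp continuous_snd)
  · rw [mem_prod, not_and_or] at hz
    exact mul_eq_zero.2 (hz.imp image_eq_zero_of_notMem_tsupport image_eq_zero_of_notMem_tsupport)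

theorem memLp_fderiv_vertical {p C : ℝ} (hp : 1 ≤ p) (hqK : (K / q) ^ p < K)
    (hclosed : ∀ n, IsClosed (𝒯.shadow n))
    (hvol : ∀ n, volume (𝒯.shadow n) ≤ ENNReal.ofReal (C * mesh K n)) {f : ℝ × ℝ → ℝ}
    (hf : ∀ᵐ z, ∃ j, f =ᶠ[𝓝 z] 𝒯.staircase j) :
    MemLp (fun z => fderiv ℝ f z (0, 1)) (ENNReal.ofReal p) := by
  have hq := 𝒯.q_pos
  have hK := 𝒯.K_pos
  obtain ⟨D, hD⟩ := exists_abs_deriv_trapezoid_le 𝒯.r_pos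
  have hratio : ‖(K / q : ℝ)‖ₑ ^ p * ENNReal.ofReal (K : ℝ)⁻¹ < 1 := by
    rw [Real.enorm_of_nonneg (by positivity), ENNReal.ofReal_rpow_of_nonneg (by positivity)
      (by positivity), ← ENNReal.ofReal_mul (by positivity), ENNReal.ofReal_lt_one,
      ← div_eq_mul_inv, div_lt_one hK]
    exact hqK
  have hvol' : ∀ n, volume (𝒯.shadow n) ≤ ENNReal.ofReal C * ENNReal.ofReal (K : ℝ)⁻¹ ^ n := by
    intro n
    rw [← ENNReal.ofReal_pow (by positivity), ← ENNReal.ofReal_mul' (by positivity), inv_pow]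
    exact hvol n
  refine memLp_of_abs_le_add_sum (ENNReal.one_le_ofReal.2 hp)
    (h := 𝒯.frame.indicator fun _ => D)
    (u := fun i => (𝒯.shadow i).indicator fun _ => (K + 2 * 𝒯.k) * D * K * (K / q) ^ i)
    (measurable_fderiv_apply_const ℝ f (0, 1)).aestronglyMeasurable
    (memLp_indicator_const _ isCompact_frame.measurableSet _
      (Or.inr isCompact_frame.measure_lt_top.ne))
    (fun i => aestronglyMeasurable_const.indicator (hclosed i).measurableSet)
    (tsum_eLpNorm_indicator_geometric_ne_top (by positivity) ENNReal.ofReal_ne_top hratio hvol')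
    ?_
  filter_upwards [hf] with z ⟨j, hj⟩
  exact ⟨j, hj.fderiv_eq (𝕜 := ℝ) ▸ abs_fderiv_staircase_vertical_le hD j z⟩

theorem not_isW1pRemovable (𝒯 : BoxTree r q K) {p C : ℝ} (hp : 1 ≤ p) (hqK : (K / q) ^ p < K)
    (hclosed : ∀ n, IsClosed (𝒯.shadow n))
    (hvol : ∀ n, volume (𝒯.shadow n) ≤ ENNReal.ofReal (C * mesh K n))
    {E : Set (ℝ × ℝ)} (hE : IsClosed E) (hE0 : volume E = 0) (hsub : ⋂ n, 𝒯.shadow n ⊆ E) :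
    ¬ IsW1pRemovable (ENNReal.ofReal p) E := by
  obtain ⟨f, hf, hlim⟩ := exists_continuous_tendsto_of_le_geometric (inv_nonneg.2 𝒯.q_pos.le)
    (inv_lt_one_of_one_lt₀ 𝒯.one_lt) (fun j => (𝒯.contDiff_staircase j).continuous)
    𝒯.abs_staircase_succ_sub_le
  have hae : ∀ᵐ z : ℝ × ℝ, z ∉ E := compl_mem_ae_iff.2 hE0
  have hloc : ∀ z ∉ E, ∃ j, z ∉ 𝒯.shadow j ∧ f =ᶠ[𝓝 z] 𝒯.staircase j := fun z hz => by
    obtain ⟨j, hj⟩ := not_forall.1 fun h => hz (hsub (mem_iInter.2 h))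
    exact ⟨j, hj, eventuallyEq_staircase (hclosed j) hlim hj⟩
  have hfc : HasCompactSupport f := HasCompactSupport.intro 𝒯.isCompact_frame fun z hz =>
    tendsto_nhds_unique (hlim z) (by simp only [staircase_eq_zero_of_notMem_frame hz,
      tendsto_const_nhds_iff])
  have hdiff : ∀ z ∉ E, DifferentiableAt ℝ f z := fun z hz =>
    let ⟨j, _, hj⟩ := hloc z hz
    hj.differentiableAt_iff.2 ((contDiff_staircase j).differentiable (by simp) z)
  have hx : (fun z => fderiv ℝ f z (1, 0)) =ᵐ[volume]
      fun z => deriv 𝒯.cutoff z.1 * 𝒯.profile z.2 := by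
    filter_upwards [hae] with z hz
    obtain ⟨j, hzj, hj⟩ := hloc z hz
    rw [hj.fderiv_eq, fderiv_staircase_horizontal hzj]
  refine not_isW1pRemovable_of_integral_fderiv_ne_zero (ENNReal.one_le_ofReal.2 hp) hE hE0 hf hfc
    hdiff ((memLp_congr_ae hx).2 (memLp_deriv_cutoff_mul_profile _))
    (memLp_fderiv_vertical hp hqK hclosed hvol ?_) ?_
  · filter_upwards [hae] with z hz using (hloc z hz).imp fun _ => And.right
  · rw [integral_congr_ae hx]
    exact integral_deriv_cutoff_mul_profile_neg.ne

end BoxTree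

/-! ### Boxes of a continuous path -/

theorem mesh_pos {K : ℕ} (hK : 0 < K) (n : ℕ) : 0 < mesh K n := by
  unfold mesh; positivity

theorem mul_mesh_succ {K : ℕ} (hK : 0 < K) (n : ℕ) : K * mesh K (n + 1) = mesh K n := by
  unfold mesh; field_simp; ring

theorem tendsto_mesh {K : ℕ} (hK : 1 < K) : Tendsto (mesh K) atTop (𝓝 0) := by
  have h : mesh K = fun n => ((K : ℝ)⁻¹) ^ n := funext fun n => (inv_pow _ _).symm
  rw [h]
  exact tendsto_pow_atTop_nhds_zero_of_lt_one (by positivity)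
    (inv_lt_one_of_one_lt₀ (by exact_mod_cast hK))

namespace IsCrossingTime

variable {B : ℝ → ℝ} {δ : ℝ} {i j : ℕ} {t t' : ℝ}

theorem unique (h : IsCrossingTime B δ j t) (h' : IsCrossingTime B δ j t') : t = t' := by
  induction h generalizing t' with
  | zero => cases h'; rfl
  | succ _ hleast ih =>
    cases h' with
    | succ h₁ hleast' => obtain rfl := ih h₁; exact hleast.unique hleast'

theorem le_of_le (h : IsCrossingTime B δ i t) (h' : IsCrossingTime B δ j t') (hij : i ≤ j) :
    t ≤ t' := by
  induction h' generalizing i t with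
  | zero => obtain rfl := Nat.le_zero.1 hij; exact (h.unique .zero).le
  | succ h₁ hleast ih =>
    rcases hij.eq_or_lt with rfl | hlt
    · exact (h.unique (.succ h₁ hleast)).le
    · exact (ih h (Nat.lt_succ_iff.1 hlt)).trans hleast.1.1.le

theorem nonneg (h : IsCrossingTime B δ j t) : 0 ≤ t :=
  IsCrossingTime.zero.le_of_le h (Nat.zero_le j)

theorem isLeast_of_succ (h : IsCrossingTime B δ j t) (h' : IsCrossingTime B δ (j + 1) t') :
    IsLeast {u | t < u ∧ |B u - B t| = δ} t' := by
  cases h' with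
  | succ h₁ hleast => obtain rfl := h.unique h₁; exact hleast

theorem natCast_mul_le {τ η : ℝ}
    (hη : ∀ x ∈ Icc 0 τ, ∀ y ∈ Icc 0 τ, |x - y| < η → |B x - B y| < δ)
    (h : IsCrossingTime B δ j t) (ht : t ≤ τ) : j * η ≤ t := by
  induction h with
  | zero => simp
  | @succ j t t' h₁ hleast ih =>
    have hlt : t < t' := hleast.1.1
    have hgap : η ≤ t' - t := by
      by_contra! hcon
      have := hη t' ⟨h₁.nonneg.trans hlt.le, ht⟩ t ⟨h₁.nonneg, hlt.le.trans ht⟩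
        (by rwa [abs_of_pos (sub_pos.2 hlt)])
      exact this.ne hleast.1.2
    push_cast
    linarith [ih (hlt.le.trans ht)]

end IsCrossingTime

section Boxes

variable {B : ℝ → ℝ} {τ r s : ℝ} {K n : ℕ} {R R' : PathBox}

namespace IsBox

theorem left_lt_right (h : IsBox B τ K n R) : R.left < R.right := by
  obtain ⟨⟨j, hleft, hright⟩, -⟩ := h
  exact (hleft.isLeast_of_succ hright).1.1

theorem left_nonneg (h : IsBox B τ K n R) : 0 ≤ R.left := by
  obtain ⟨⟨j, hleft, -⟩, -⟩ := h
  exact hleft.nonneg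

theorem eq_of_left_eq (hK : 0 < K) (h : IsBox B τ K n R) (h' : IsBox B τ K n R')
    (hleft : R.left = R'.left) (hright : R.right = R'.right) : R = R' := by
  refine PathBox.ext hleft hright ?_
  have hlevel := h.2.2.1
  rw [hleft, h'.2.2.1] at hlevel
  exact_mod_cast (mul_right_cancel₀ (mesh_pos hK n).ne' hlevel).symm

theorem eq_or_right_le_left (hK : 0 < K) (h : IsBox B τ K n R) (h' : IsBox B τ K n R') :
    R = R' ∨ R.right ≤ R'.left ∨ R'.right ≤ R.left := by
  obtain ⟨i, hl, hr⟩ := h.1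
  obtain ⟨j, hl', hr'⟩ := h'.1
  rcases lt_trichotomy i j with hij | rfl | hij
  · exact .inr (.inl (hr.le_of_le hl' hij))
  · exact .inl (h.eq_of_left_eq hK h' (hl.unique hl') (hr.unique hr'))
  · exact .inr (.inr (hr'.le_of_le hl hij))

theorem abs_sub_left_le (hB : ContinuousOn B (Icc 0 τ)) (hK : 0 < K) (h : IsBox B τ K n R)
    {t : ℝ} (ht : t ∈ Icc R.left R.right) : |B t - B R.left| ≤ mesh K n := by
  obtain ⟨⟨j, hleft, hright⟩, hτ, -⟩ := h
  by_contra! hcon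
  have hcont : ContinuousOn (fun u => |B u - B R.left|) (Icc R.left t) :=
    ((hB.mono (Icc_subset_Icc hleft.nonneg (ht.2.trans hτ))).sub continuousOn_const).abs
  obtain ⟨u, hu, hmesh⟩ : ∃ u ∈ Ioo R.left t, |B u - B R.left| = mesh K n :=
    intermediate_value_Ioo ht.1 hcont
      ⟨by simpa only [sub_self, abs_zero] using mesh_pos hK n, hcon⟩
  exact (hu.2.trans_le ht.2).not_ge ((hleft.isLeast_of_succ hright).2 ⟨hu.1, hmesh⟩)

theorem abs_sub_le_of_mem_extended (hB : ContinuousOn B (Icc 0 τ)) (hK : 0 < K)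
    (h : IsBox B τ K n R) (hr : 3 * r ≤ 1) {z : ℝ × ℝ} (hz : z ∈ R.extended r K n) :
    z.1 ∈ Icc 0 τ ∧ |z.2 - B z.1| ≤ 2 * mesh K n := by
  obtain ⟨hz₁, hz₂, hz₃⟩ := hz
  refine ⟨⟨h.left_nonneg.trans hz₁.1, hz₁.2.trans h.2.1⟩, ?_⟩
  have hosc := h.abs_sub_left_le hB hK hz₁
  have hext := mul_le_mul_of_nonneg_right hr (mesh_pos hK n).le
  rw [h.2.2.1, abs_le] at hosc
  rw [abs_le]
  constructor <;> linarith

end IsBox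

theorem finite_setOf_isBox (hB : ContinuousOn B (Icc 0 τ)) (hK : 0 < K) (n : ℕ) :
    {R | IsBox B τ K n R}.Finite := by
  obtain ⟨η, hη₀, hη⟩ := Metric.uniformContinuousOn_iff.1
    (isCompact_Icc.uniformContinuousOn_of_continuous hB) (mesh K n) (mesh_pos hK n)
  simp only [Real.dist_eq] at hη
  have hfin : (⋃ j ∈ Iic ⌊τ / η⌋₊, {R | IsBox B τ K n R ∧ IsCrossingTime B (mesh K n) j R.left ∧
      IsCrossingTime B (mesh K n) (j + 1) R.right}).Finite := by
    refine (finite_Iic _).biUnion fun j _ => Set.Subsingleton.finite ?_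
    rintro R ⟨hR, hl, hr⟩ R' ⟨hR', hl', hr'⟩
    exact hR.eq_of_left_eq hK hR' (hl.unique hl') (hr.unique hr')
  refine hfin.subset fun R hR => ?_
  obtain ⟨j, hl, hr⟩ := hR.1
  have hleft : R.left ≤ τ := hR.left_lt_right.le.trans hR.2.1
  have hj : (j : ℝ) ≤ τ / η := (le_div_iff₀ hη₀).2 ((hl.natCast_mul_le hη hleft).trans hleft)
  exact mem_iUnion₂.2 ⟨j, Nat.le_floor hj, hR, hl, hr⟩

theorem exists_forall_lt_right_le_left {S : Finset PathBox} (hlt : ∀ R ∈ S, R.left < R.right)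
    (hS : ∀ R ∈ S, ∀ R' ∈ S, R = R' ∨ R.right ≤ R'.left ∨ R'.right ≤ R.left) :
    ∃ f : Fin S.card → PathBox, (∀ i, f i ∈ S) ∧ ∀ i j, i < j → (f i).right ≤ (f j).left := by
  classical
  have hinj : InjOn PathBox.left (S : Set PathBox) := by
    intro R hR R' hR' heq
    rcases hS R hR R' hR' with h | h | h
    · exact h
    · linarith [hlt R hR]
    · linarith [hlt R' hR']
  have hcard : (S.image PathBox.left).card = S.card := Finset.card_image_of_injOn hinj
  have hleft : ∀ i, ∃ R ∈ S, R.left = (S.image PathBox.left).orderEmbOfFin hcard i := fun i =>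
    Finset.mem_image.1 (Finset.orderEmbOfFin_mem _ hcard i)
  choose f hfS hf using hleft
  refine ⟨f, hfS, fun i j hij => ?_⟩
  have hfij : (f i).left < (f j).left := by
    rw [hf, hf]
    exact (Finset.orderEmbOfFin _ hcard).strictMono hij
  rcases hS _ (hfS i) _ (hfS j) with h | h | h
  · exact absurd (congrArg PathBox.left h) hfij.ne
  · exact h
  · linarith [hlt _ (hfS j)]

theorem hasUpcrossings_card_of_isChildAt (hK : 0 < K) {m : ℤ} {S : Finset PathBox}
    (hS : ∀ R' ∈ S, IsChildAt B τ K n R R' m) :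
    HasUpcrossings B R.left R.right (R.level * mesh K n + m * mesh K (n + 1))
      (R.level * mesh K n + (m + 1) * mesh K (n + 1)) S.card := by
  obtain ⟨f, hfS, hf⟩ := exists_forall_lt_right_le_left
    (fun R' hR' => (hS R' hR').1.left_lt_right)
    (fun R₁ h₁ R₂ h₂ => (hS R₁ h₁).1.eq_or_right_le_left hK (hS R₂ h₂).1)
  refine ⟨fun i => (f i).left, fun i => (f i).right, fun i => ?_, hf⟩
  obtain ⟨hbox, hleft, hright, hlevel⟩ := hS _ (hfS i)
  refine ⟨hleft, hbox.left_lt_right, hright, le_of_eq ?_, le_of_eq ?_⟩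
  · rw [hbox.2.2.1, hlevel, ← mul_mesh_succ hK n]; push_cast; ring
  · rw [hbox.2.2.2, hlevel, ← mul_mesh_succ hK n]; push_cast; ring

end Boxes

section GoodBoxes

variable {B : ℝ → ℝ} {τ r s : ℝ} {K n : ℕ} {R : PathBox}

-- The path would otherwise leave the box at the bottom before its upcrossings at height `-3rK`.
theorem IsGoodBox.three_mul_le_one (hB : ContinuousOn B (Icc 0 τ)) (hK : 0 < K)
    (hrK : ∃ k : ℕ, r * K = k) (hs : 0 < s) (h : IsGoodBox B τ K r s n R) : 3 * r ≤ 1 := by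
  obtain ⟨k, hk⟩ := hrK
  have hK₁ : (1 : ℝ) ≤ K := by exact_mod_cast hK
  have hheight : -(3 * (k : ℤ)) ∈ childHeights r K := by
    constructor <;> push_cast
    · rw [mul_assoc, hk]
    · rw [hk]; linarith [k.cast_nonneg (α := ℝ)]
  obtain ⟨N, hN, σ, ρ, hcross, -⟩ := h.2 _ hheight
  have hN₀ : 0 < N := Nat.cast_pos.1 ((mul_pos hs (one_pos.trans_le hK₁)).trans_le hN)
  obtain ⟨hσ, hσρ, hρ, hlow, -⟩ := hcross ⟨0, hN₀⟩
  have hosc := (abs_le.1 (h.1.abs_sub_left_le hB hK ⟨hσ, hσρ.le.trans hρ⟩)).1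
  have hdepth : ((-(3 * (k : ℤ)) : ℤ) : ℝ) * mesh K (n + 1) = -(3 * r) * mesh K n := by
    rw [← mul_mesh_succ hK n]; push_cast; rw [← hk]; ring
  rw [h.1.2.2.1] at hosc
  refine le_of_mul_le_mul_right ?_ (mesh_pos hK n)
  linarith

theorem IsNGood.isBox {k : ℕ} (h : IsNGood B τ K r s k n R) : IsBox B τ K n R := by
  match k, h with
  | 0, h => exact h
  | 1, h => exact h.1
  | _ + 2, h => exact h.1

theorem IsInftyGood.isBox (h : IsInftyGood B τ K r s n R) : IsBox B τ K n R :=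
  (h 1 le_rfl).isBox

theorem IsNGood.of_succ (hK : 0 < K) {k : ℕ} (h : IsNGood B τ K r s (k + 2) n R) :
    IsNGood B τ K r s (k + 1) n R := by
  induction k generalizing n R with
  | zero =>
    refine ⟨h.1, fun m hm => ?_⟩
    obtain ⟨S, hcard, hS⟩ := h.2 m hm
    exact ⟨S.card, hcard, hasUpcrossings_card_of_isChildAt hK fun R' hR' => (hS R' hR').1⟩
  | succ k ih =>
    refine ⟨h.1, fun m hm => ?_⟩
    obtain ⟨S, hcard, hS⟩ := h.2 m hm
    exact ⟨S, hcard, fun R' hR' => ⟨(hS R' hR').1, ih (hS R' hR').2⟩⟩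

theorem antitone_isNGood_succ (hK : 0 < K) (n : ℕ) (R : PathBox) :
    Antitone fun k => IsNGood B τ K r s (k + 1) n R :=
  antitone_nat_of_succ_le fun _ => IsNGood.of_succ hK

theorem exists_forall_isNGood_imp_isInftyGood (hB : ContinuousOn B (Icc 0 τ)) (hK : 0 < K)
    (n : ℕ) : ∃ k, ∀ R, IsNGood B τ K r s (k + 1) n R → IsInftyGood B τ K r s n R := by
  have hev : ∀ᶠ k in atTop, ∀ R ∈ {R | IsBox B τ K n R},
      IsNGood B τ K r s (k + 1) n R → IsInftyGood B τ K r s n R := by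
    refine (eventually_all_finite (finite_setOf_isBox hB hK n)).2 fun R _ => ?_
    by_cases hR : IsInftyGood B τ K r s n R
    · exact .of_forall fun _ _ => hR
    · have hbad : ∃ l, 1 ≤ l ∧ ¬ IsNGood B τ K r s l n R := by
        simpa only [IsInftyGood, not_forall, exists_prop] using hR
      obtain ⟨l, hl, hbad⟩ := hbad
      obtain ⟨l, rfl⟩ := Nat.exists_eq_add_of_le' hl
      filter_upwards [eventually_ge_atTop l] with k hk hgood
      exact absurd (antitone_isNGood_succ hK n R hk hgood) hbad
  obtain ⟨k, hk⟩ := hev.exists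
  exact ⟨k, fun R hR => hk R hR.isBox hR⟩

theorem IsInftyGood.exists_children (hB : ContinuousOn B (Icc 0 τ)) (hK : 0 < K)
    (h : IsInftyGood B τ K r s n R) {m : ℤ} (hm : m ∈ childHeights r K) :
    ∃ S : Finset PathBox, s * K ≤ (S.card : ℝ) ∧
      ∀ R' ∈ S, IsChildAt B τ K n R R' m ∧ IsInftyGood B τ K r s (n + 1) R' := by
  obtain ⟨k, hk⟩ := exists_forall_isNGood_imp_isInftyGood (r := r) (s := s) hB hK (n + 1)
  obtain ⟨S, hcard, hS⟩ := (h (k + 2) (by omega)).2 m hm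
  exact ⟨S, hcard, fun R' hR' => ⟨(hS R' hR').1, hk R' (hS R' hR').2⟩⟩

/-- The largest nested family: the infinitely good descendants, through infinitely good boxes, of
the box at scale `0`. -/
def goodDescendants (B : ℝ → ℝ) (τ : ℝ) (K : ℕ) (r s : ℝ) : ℕ → Set PathBox
  | 0 => {rootBox τ}
  | n + 1 => {R' | IsInftyGood B τ K r s (n + 1) R' ∧
      ∃ R ∈ goodDescendants B τ K r s n, ∃ m ∈ childHeights r K, IsChildAt B τ K n R R' m}

theorem isNestedFamily_goodDescendants (hB : ContinuousOn B (Icc 0 τ)) (hK : 0 < K)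
    (h : IsInftyGood B τ K r s 0 (rootBox τ)) :
    IsNestedFamily B τ K r s (goodDescendants B τ K r s) := by
  have hgood : ∀ n, ∀ R ∈ goodDescendants B τ K r s n, IsInftyGood B τ K r s n R := by
    rintro (_ | n) R hR
    · obtain rfl : R = rootBox τ := hR
      exact h
    · exact hR.1
  refine ⟨rfl, hgood, fun n R' hR' => hR'.2, fun n R hR m hm => ?_⟩
  obtain ⟨S, hcard, hS⟩ := (hgood n R hR).exists_children hB hK hm
  exact ⟨S, hcard, fun R' hR' => ⟨⟨(hS R' hR').2, R, hR, m, hm, (hS R' hR').1⟩, (hS R' hR').1⟩⟩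

end GoodBoxes

section Graphs

variable {B : ℝ → ℝ} {τ : ℝ}

theorem volume_le_of_forall_abs_sub_lt {s : Set ℝ} (hs : MeasurableSet s)
    (hB : ContinuousOn B s) {ε : ℝ} {E : Set (ℝ × ℝ)}
    (hE : ∀ z ∈ E, z.1 ∈ s ∧ |z.2 - B z.1| < ε) :
    volume E ≤ ENNReal.ofReal (2 * ε) * volume s := by
  have hsub : E ⊆ regionBetween (fun x => B x - ε) (fun x => B x + ε) s := by
    intro z hz
    obtain ⟨hz₁, hz₂⟩ := hE z hz
    rw [abs_lt] at hz₂
    exact ⟨hz₁, by linarith, by linarith⟩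
  have hmeas : AEMeasurable B (volume.restrict s) := hB.aemeasurable hs
  calc volume E ≤ ∫⁻ x in s, ENNReal.ofReal ((B x + ε) - (B x - ε)) := by
        refine (measure_mono hsub).trans_eq ?_
        rw [Measure.volume_eq_prod, volume_regionBetween_eq_lintegral (hmeas.sub_const ε)
          (hmeas.add_const ε) hs]
        rfl
    _ = ENNReal.ofReal (2 * ε) * volume s := by
        simp only [add_sub_sub_cancel, ← two_mul, setLIntegral_const]

theorem isCompact_pathGraph (hB : ContinuousOn B (Icc 0 τ)) : IsCompact (pathGraph B τ) :=
  isCompact_Icc.image_of_continuousOn (continuousOn_id.prodMk hB)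

theorem volume_pathGraph (hB : ContinuousOn B (Icc 0 τ)) : volume (pathGraph B τ) = 0 := by
  have hle : ∀ ε > 0, volume (pathGraph B τ) ≤ ENNReal.ofReal (2 * ε) * volume (Icc 0 τ) := by
    refine fun ε hε => volume_le_of_forall_abs_sub_lt measurableSet_Icc hB ?_
    rintro _ ⟨t, ht, rfl⟩
    exact ⟨ht, by simpa only [sub_self, abs_zero] using hε⟩
  have hlim : Tendsto (fun ε => ENNReal.ofReal (2 * ε) * volume (Icc 0 τ)) (𝓝[>] 0) (𝓝 0) := by
    have hmul : Tendsto (fun ε : ℝ => 2 * ε) (𝓝[>] 0) (𝓝 0) :=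
      (continuous_const_mul (2 : ℝ)).tendsto' 0 0 (mul_zero 2) |>.mono_left nhdsWithin_le_nhds
    simpa only [ENNReal.ofReal_zero, zero_mul] using
      ENNReal.Tendsto.mul_const (ENNReal.tendsto_ofReal hmul) (.inr measure_Icc_lt_top.ne)
  exact le_antisymm (ge_of_tendsto hlim (eventually_mem_nhdsWithin.mono hle)) zero_le

end Graphs

/-! ### Nested families -/

theorem one_lt_mul_of_rpow_neg_lt {p s x : ℝ} (hp : 1 ≤ p) (hs : 0 < s) (hx : 1 < x)
    (h : s ^ (-p) < x) : 1 < s * x := by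
  rcases lt_or_ge s 1 with hs₁ | hs₁
  · have hinv : s⁻¹ ≤ s ^ (-p) := by
      rw [← Real.rpow_neg_one]
      exact Real.rpow_le_rpow_of_exponent_ge hs hs₁.le (neg_le_neg hp)
    rw [mul_comm]
    exact (inv_lt_iff_one_lt_mul₀ hs).1 (hinv.trans_lt h)
  · exact hx.trans_le (le_mul_of_one_le_left (one_pos.trans hx).le hs₁)

theorem sub_three_mul_mem_childHeights {r : ℝ} {K k : ℕ} (hrK : r * K = k)
    (i : Fin (K + 2 * k)) : ((i : ℕ) - 3 * k : ℤ) ∈ childHeights r K := by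
  have hi : ((i : ℕ) : ℝ) + 1 ≤ K + 2 * k := by exact_mod_cast i.2
  constructor <;> push_cast
  · rw [mul_assoc, hrK]; linarith [(i : ℕ).cast_nonneg (α := ℝ)]
  · rw [hrK]; linarith

namespace IsNestedFamily

variable {B : ℝ → ℝ} {τ r s : ℝ} {K : ℕ} {F : ℕ → Set PathBox}

theorem isBox (hF : IsNestedFamily B τ K r s F) {n : ℕ} {R : PathBox} (hR : R ∈ F n) :
    IsBox B τ K n R :=
  (hF.good n R hR).isBox

theorem rootBox_mem (hF : IsNestedFamily B τ K r s F) : rootBox τ ∈ F 0 := by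
  rw [hF.root]; rfl

theorem three_mul_le_one (hF : IsNestedFamily B τ K r s F) (hB : ContinuousOn B (Icc 0 τ))
    (hK : 0 < K) (hrK : ∃ k : ℕ, r * K = k) (hs : 0 < s) : 3 * r ≤ 1 :=
  IsGoodBox.three_mul_le_one hB hK hrK hs (hF.good 0 _ hF.rootBox_mem 1 le_rfl)

theorem exists_boxTree (hF : IsNestedFamily B τ K r s F) (hr : 0 < r) (hK : 3 ≤ K)
    (hrK : ∃ k : ℕ, r * K = k) (hsK : 1 < s * K) :
    ∃ 𝒯 : BoxTree r (s * K) K, ∀ n, 𝒯.shadow n = ⋃ R ∈ F n, R.extended r K n := by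
  classical
  obtain ⟨k, hk⟩ := hrK
  choose S hcard hmem hchild using fun n (R : F n) (i : Fin (K + 2 * k)) => by
    simpa only [forall_and] using hF.children n R R.2 _ (sub_three_mul_mem_childHeights hk i)
  refine ⟨{
    k, mul_eq := hk, r_pos := hr, three_le := hK, one_lt := hsK
    Node n := F n
    root := ⟨rootBox τ, hF.rootBox_mem⟩
    box R := R
    children R i := (S _ R i).subtype (· ∈ F _)
    left_lt_right R := (hF.isBox R.2).left_lt_right
    left_le hR' := (hchild _ _ _ _ (Finset.mem_subtype.1 hR')).2.1
    right_le hR' := (hchild _ _ _ _ (Finset.mem_subtype.1 hR')).2.2.1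
    level_eq hR' := (hchild _ _ _ _ (Finset.mem_subtype.1 hR')).2.2.2
    le_card R i := by
      rw [Finset.card_subtype, Finset.filter_true_of_mem (hmem _ R i)]
      exact hcard _ R i
    pairwiseDisjoint R i R₁ _ R₂ _ hne := ?_ }, fun n => ?_⟩
  · rw [Function.onFun, Ioo_disjoint_Ioo]
    rcases (hF.isBox R₁.2).eq_or_right_le_left (by omega) (hF.isBox R₂.2) with h | h | h
    · exact absurd (Subtype.ext h) hne
    · exact (min_le_left _ _).trans (h.trans (le_max_right _ _))
    · exact (min_le_right _ _).trans (h.trans (le_max_left _ _))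
  · exact iUnion_subtype (· ∈ F n) fun R => (R : PathBox).extended r K n

theorem isCompact_iUnion_extended (hF : IsNestedFamily B τ K r s F)
    (hB : ContinuousOn B (Icc 0 τ)) (hK : 0 < K) (n : ℕ) :
    IsCompact (⋃ R ∈ F n, R.extended r K n) :=
  ((finite_setOf_isBox hB hK n).subset fun _ hR => hF.isBox hR).isCompact_biUnion
    fun _ _ => isCompact_Icc.prod isCompact_Icc

theorem isCompact_familyLimitSet (hF : IsNestedFamily B τ K r s F)
    (hB : ContinuousOn B (Icc 0 τ)) (hK : 0 < K) : IsCompact (familyLimitSet r K F) :=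
  (hF.isCompact_iUnion_extended hB hK 0).of_isClosed_subset
    (isClosed_iInter fun n => (hF.isCompact_iUnion_extended hB hK n).isClosed)
    (iInter_subset _ 0)

theorem abs_sub_le_of_mem_iUnion_extended (hF : IsNestedFamily B τ K r s F)
    (hB : ContinuousOn B (Icc 0 τ)) (hK : 0 < K) (hr : 3 * r ≤ 1) {n : ℕ} {z : ℝ × ℝ}
    (hz : z ∈ ⋃ R ∈ F n, R.extended r K n) : z.1 ∈ Icc 0 τ ∧ |z.2 - B z.1| ≤ 2 * mesh K n := by
  obtain ⟨R, hR, hzR⟩ := mem_iUnion₂.1 hz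
  exact (hF.isBox hR).abs_sub_le_of_mem_extended hB hK hr hzR

theorem familyLimitSet_subset_pathGraph (hF : IsNestedFamily B τ K r s F)
    (hB : ContinuousOn B (Icc 0 τ)) (hK : 1 < K) (hr : 3 * r ≤ 1) :
    familyLimitSet r K F ⊆ pathGraph B τ := by
  intro z hz
  have hclose : ∀ n, z.1 ∈ Icc 0 τ ∧ |z.2 - B z.1| ≤ 2 * mesh K n := fun n =>
    hF.abs_sub_le_of_mem_iUnion_extended hB (by omega) hr (mem_iInter.1 hz n)
  have hlim : Tendsto (fun n => 2 * mesh K n) atTop (𝓝 0) := by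
    simpa only [mul_zero] using (tendsto_mesh hK).const_mul 2
  have heq : z.2 = B z.1 :=
    sub_eq_zero.1 (abs_nonpos_iff.1 (ge_of_tendsto' hlim fun n => (hclose n).2))
  exact ⟨z.1, (hclose 0).1, Prod.ext rfl heq.symm⟩

theorem volume_iUnion_extended_le (hF : IsNestedFamily B τ K r s F)
    (hB : ContinuousOn B (Icc 0 τ)) (hK : 0 < K) (hr : 3 * r ≤ 1) (n : ℕ) :
    volume (⋃ R ∈ F n, R.extended r K n) ≤ ENNReal.ofReal (6 * τ * mesh K n) := by
  have hmesh := mesh_pos hK n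
  calc volume (⋃ R ∈ F n, R.extended r K n)
      ≤ ENNReal.ofReal (2 * (3 * mesh K n)) * volume (Icc 0 τ) := by
        refine volume_le_of_forall_abs_sub_lt measurableSet_Icc hB fun z hz => ?_
        obtain ⟨hz₁, hz₂⟩ := hF.abs_sub_le_of_mem_iUnion_extended hB hK hr hz
        exact ⟨hz₁, hz₂.trans_lt (by linarith)⟩
    _ = ENNReal.ofReal (6 * τ * mesh K n) := by
        rw [Real.volume_Icc, sub_zero, ← ENNReal.ofReal_mul (by positivity)]
        congr 1
        ring

theorem three_le (hF : IsNestedFamily B τ K r s F) (hB : ContinuousOn B (Icc 0 τ))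
    (hK : 0 < K) (hr : 0 < r) (hrK : ∃ k : ℕ, r * K = k) (hs : 0 < s) : 3 ≤ K := by
  have hr₃ := hF.three_mul_le_one hB hK hrK hs
  obtain ⟨k, hk⟩ := hrK
  have hk₁ : (1 : ℝ) ≤ k := by
    have : (0 : ℝ) < k := hk ▸ mul_pos hr (Nat.cast_pos.2 hK)
    exact_mod_cast this
  have hK₃ : (3 : ℝ) ≤ K := by
    nlinarith [mul_le_mul_of_nonneg_right hr₃ K.cast_nonneg]
  exact_mod_cast hK₃

theorem not_isW1pRemovable (hF : IsNestedFamily B τ K r s F) (hB : ContinuousOn B (Icc 0 τ))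
    (hr : 0 < r) (hrK : ∃ k : ℕ, r * K = k) (hs : 0 < s) {p : ℝ} (hp : 1 ≤ p)
    (hsK : s ^ (-p) < K) {E : Set (ℝ × ℝ)} (hE : IsClosed E) (hE₀ : volume E = 0)
    (hsub : familyLimitSet r K F ⊆ E) : ¬ IsW1pRemovable (ENNReal.ofReal p) E := by
  have hK : 0 < K := Nat.cast_pos.1 ((Real.rpow_pos_of_pos hs (-p)).trans hsK)
  have hr₃ : 3 * r ≤ 1 := hF.three_mul_le_one hB hK hrK hs
  have hK₃ : 3 ≤ K := hF.three_le hB hK hr hrK hs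
  have hK₁ : (1 : ℝ) < K := by exact_mod_cast (by omega : 1 < K)
  obtain ⟨𝒯, h𝒯⟩ := hF.exists_boxTree hr hK₃ hrK (one_lt_mul_of_rpow_neg_lt hp hs hK₁ hsK)
  have hratio : (K / (s * K)) ^ p < (K : ℝ) := by
    rwa [mul_comm, div_mul_cancel_left₀ (one_pos.trans hK₁).ne', Real.inv_rpow hs.le,
      ← Real.rpow_neg hs.le]
  refine 𝒯.not_isW1pRemovable hp hratio (C := 6 * τ) (fun n => ?_) (fun n => ?_) hE hE₀ ?_
  · rw [h𝒯]; exact (hF.isCompact_iUnion_extended hB hK n).isClosed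
  · rw [h𝒯]; exact hF.volume_iUnion_extended_le hB hK hr₃ n
  · simp only [h𝒯]; exact hsub

end IsNestedFamily

theorem proposition2p4 (p : ℝ) (hp : 1 ≤ p)
    -- a continuous path from `0` that hits `1` before `-1`, at time `τ`
    (B : ℝ → ℝ) (τ : ℝ) (hτ : 0 < τ) (hB : ContinuousOn B (Set.Icc 0 τ))
    (hB0 : B 0 = 0) (hBτ : B τ = 1) (hBlt : ∀ t ∈ Set.Ico 0 τ, |B t| < 1)
    -- the parameters, with `s = c / 2`
    (K : ℕ) (r c : ℝ) (hr : 0 < r) (hc : 0 < c) (hrK : ∃ k : ℕ, r * K = k)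
    (hK : (c / 2) ^ (-p) < (K : ℝ))
    (hgood : IsInftyGood B τ K r (c / 2) 0 (rootBox τ)) :
    (IsCompact (pathGraph B τ) ∧ ¬ IsW1pRemovable (ENNReal.ofReal p) (pathGraph B τ)) ∧
    (∃ F : ℕ → Set PathBox, IsNestedFamily B τ K r (c / 2) F) ∧
    ∀ F : ℕ → Set PathBox, IsNestedFamily B τ K r (c / 2) F →
      familyLimitSet r K F ⊆ pathGraph B τ ∧ IsCompact (familyLimitSet r K F) ∧
        ¬ IsW1pRemovable (ENNReal.ofReal p) (familyLimitSet r K F) := by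
  have hs : 0 < c / 2 := half_pos hc
  have hK₀ : 0 < K := Nat.cast_pos.1 ((Real.rpow_pos_of_pos hs (-p)).trans hK)
  have hF₀ := isNestedFamily_goodDescendants hB hK₀ hgood
  have hr₃ : 3 * r ≤ 1 := hF₀.three_mul_le_one hB hK₀ hrK hs
  have hK₃ : 3 ≤ K := hF₀.three_le hB hK₀ hr hrK hs
  have hsub : ∀ F, IsNestedFamily B τ K r (c / 2) F → familyLimitSet r K F ⊆ pathGraph B τ :=
    fun F hF => hF.familyLimitSet_subset_pathGraph hB (by omega) hr₃
  have hgraph := isCompact_pathGraph hB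
  have hgraph₀ := volume_pathGraph hB
  refine ⟨⟨hgraph, ?_⟩, ⟨_, hF₀⟩, fun F hF => ?_⟩
  · exact hF₀.not_isW1pRemovable hB hr hrK hs hp hK hgraph.isClosed hgraph₀ (hsub _ hF₀)
  · have hlimit := hF.isCompact_familyLimitSet hB hK₀
    exact ⟨hsub F hF, hlimit, hF.not_isW1pRemovable hB hr hrK hs hp hK hlimit.isClosed
      (measure_mono_null (hsub F hF) hgraph₀) subset_rfl⟩
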